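/- \textbf{Lemma (Hartree-type nonlinearities).} Let $2\le p\le\infty$ with $p>d/4$, let $W\in L^{\infty}(\mathbb{R}^d)+L^{p}(\mathbb{R}^d)$ (complex valued), let $s>d/2$, and set $H_1=H^s(\mathbb{R}^d)$, $H_0=L^2(\mathbb{R}^d)$ (complex-valued functions). Then: (i) The convolutions $W*|u|^2$ and $W*\operatorname{Re}(u^*v)$ exist at every point of $\mathbb{R}^d$ for all $u\in H_1$, $v\in H_0$, and $B(u)=(W*|u|^2)\,u$ is a well-defined map $B:H_1\to H_1$. (ii) For every $u\in H_1$, $B'(u)v=(W*|u|^2)\,v+2\,\bigl(W*\operatorname{Re}(u^*v)\bigr)\,u$ defines a bounded real-linear operator on $H_0$, so that $B'$ is a well-defined map from $H_1$ to the space $\mathcal{B}(H_0)$ of bounded real-linear operators on $H_0$. (iii) For all $R,\varepsilon>0$ there exist $C,\delta>0$ such that, for all $u,w\in H_1$ with $\|u\|_{H_1}\le R$ and $\|w\|_{H_1}<\delta$, $$\|B'(u)\|_{\mathcal{B}(H_0)}\le C,\qquad \|B(u+w)-B(u)-B'(u)w\|_{H_0}\le\varepsilon\,\|w\|_{H_0}.$$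 -/

import Mathlib

open MeasureTheory TemperedDistribution
open scoped ENNReal SchwartzMap Convolution ComplexConjugate

noncomputable section

/-- Euclidean space `ℝ^d`. -/
abbrev Eucl (d : ℕ) : Type := EuclideanSpace ℝ (Fin d)

/-- The space `L²(ℝ^d)` of complex-valued functions. -/
abbrev L2 (d : ℕ) : Type := Lp ℂ 2 (volume : Measure (Eucl d))

/-- `L²` functions are determined by the tempered distribution they induce. -/
theorem L2.toTemperedDistribution_injective {d : ℕ} {f g : L2 d}
    (h : (f : 𝓢'(Eucl d, ℂ)) = (g : 𝓢'(Eucl d, ℂ))) : f = g := by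
  have hk := Lp.ker_toTemperedDistributionCLM_eq_bot (E := Eucl d) (F := ℂ)
    (μ := volume) (p := 2)
  exact (LinearMap.ker_eq_bot.mp hk) h

/-- The elements of the Sobolev space `H^s(ℝ^d)`, `s ≥ 0`, as a subspace of `L²(ℝ^d)`:
those `u` with `𝓕⁻ (1 + |ξ|²)^(s/2) 𝓕 u ∈ L²`. -/
def sobolevSubmodule (d : ℕ) (s : ℝ) : Submodule ℂ (L2 d) where
  carrier := {u | MemSobolev s 2 (u : 𝓢'(Eucl d, ℂ))}
  add_mem' {u v} hu hv := by
    have h := hu.add hv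
    simp only [← Lp.toTemperedDistributionCLM_apply] at h
    simpa only [Set.mem_ofPred_eq, ← Lp.toTemperedDistributionCLM_apply, map_add] using h
  zero_mem' := by
    simp only [Set.mem_ofPred_eq, ← Lp.toTemperedDistributionCLM_apply, map_zero]
    exact memSobolev_fun_zero _ _ s 2
  smul_mem' c u hu := by
    have h := MemSobolev.smul c hu
    simp only [← Lp.toTemperedDistributionCLM_apply] at h
    simpa only [Set.mem_ofPred_eq, ← Lp.toTemperedDistributionCLM_apply, map_smul] using h

/-- The Sobolev space `H^s(ℝ^d)`, `s ≥ 0`, as a type of its own; it does not carry the norm of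
`L²(ℝ^d)` but the Sobolev norm defined below. -/
def HSob (d : ℕ) (s : ℝ) : Type := sobolevSubmodule d s

namespace HSob

variable {d : ℕ} {s : ℝ}

instance : AddCommGroup (HSob d s) := inferInstanceAs (AddCommGroup (sobolevSubmodule d s))

instance : Module ℂ (HSob d s) := inferInstanceAs (Module ℂ (sobolevSubmodule d s))

/-- The inclusion `H^s(ℝ^d) → L²(ℝ^d)`. -/
def toL2 : HSob d s →ₗ[ℂ] L2 d := (sobolevSubmodule d s).subtype

theorem memSobolev (u : HSob d s) : MemSobolev s 2 (toL2 u : 𝓢'(Eucl d, ℂ)) := u.2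

/-- The Bessel potential `J^s u = 𝓕⁻ (1 + |ξ|²)^(s/2) 𝓕 u` of `u ∈ H^s(ℝ^d)`, as a function
in `L²(ℝ^d)`. -/
def bessel : HSob d s →ₗ[ℂ] L2 d where
  toFun u := u.memSobolev.choose
  map_add' u v := by
    apply L2.toTemperedDistribution_injective
    rw [← (u + v).memSobolev.choose_spec]
    simp only [← Lp.toTemperedDistributionCLM_apply, map_add]
    simp only [Lp.toTemperedDistributionCLM_apply]
    rw [← u.memSobolev.choose_spec, ← v.memSobolev.choose_spec]
  map_smul' c u := by
    apply L2.toTemperedDistribution_injective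
    rw [← (c • u).memSobolev.choose_spec]
    simp only [← Lp.toTemperedDistributionCLM_apply, map_smul, RingHom.id_apply]
    simp only [Lp.toTemperedDistributionCLM_apply]
    rw [← u.memSobolev.choose_spec]

theorem besselPotential_toL2 (u : HSob d s) :
    besselPotential (Eucl d) ℂ s (toL2 u : 𝓢'(Eucl d, ℂ)) = (bessel u : 𝓢'(Eucl d, ℂ)) :=
  u.memSobolev.choose_spec

theorem bessel_injective : Function.Injective (bessel : HSob d s →ₗ[ℂ] L2 d) := by
  intro u v h
  have h1 : besselPotential (Eucl d) ℂ s (toL2 u : 𝓢'(Eucl d, ℂ)) =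
      besselPotential (Eucl d) ℂ s (toL2 v : 𝓢'(Eucl d, ℂ)) := by
    rw [besselPotential_toL2, besselPotential_toL2, h]
  have h2 := congrArg (besselPotential (Eucl d) ℂ (-s)) h1
  simp only [besselPotential_besselPotential_apply, add_neg_cancel, besselPotential_zero,
    ContinuousLinearMap.id_apply] at h2
  exact Subtype.ext (L2.toTemperedDistribution_injective h2)

/-- The Sobolev norm `‖u‖_{H^s} = ‖𝓕⁻ (1 + |ξ|²)^(s/2) 𝓕 u‖_{L²}`. -/
instance : NormedAddCommGroup (HSob d s) :=
  NormedAddCommGroup.induced (HSob d s) (L2 d) bessel bessel_injective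

theorem norm_eq (u : HSob d s) : ‖u‖ = ‖bessel u‖ := rfl

instance : NormedSpace ℂ (HSob d s) := NormedSpace.induced ℂ (HSob d s) (L2 d) bessel

end HSob

/-- `W ∈ L^p(ℝ^d) + L^q(ℝ^d)`. -/
def MemLpAdd {d : ℕ} (W : Eucl d → ℂ) (p q : ℝ≥0∞) : Prop :=
  ∃ W₁ W₂ : Eucl d → ℂ, MemLp W₁ p volume ∧ MemLp W₂ q volume ∧ W =ᵐ[volume] W₁ + W₂

/-- The convolution `(W ∗ g)(x) = ∫ W(y) g(x - y) dy` exists at every `x`. -/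
def ConvExists {d : ℕ} (W : Eucl d → ℂ) (g : Eucl d → ℝ) : Prop :=
  ConvolutionExists W (fun y => (g y : ℂ)) (ContinuousLinearMap.mul ℂ ℂ) volume

/-- The convolution `(W ∗ g)(x) = ∫ W(y) g(x - y) dy`. -/
def conv {d : ℕ} (W : Eucl d → ℂ) (g : Eucl d → ℝ) : Eucl d → ℂ :=
  W ⋆[ContinuousLinearMap.mul ℂ ℂ, volume] (fun y => (g y : ℂ))

/-- The function `|u|²`. -/
def absSq {d : ℕ} (u : Eucl d → ℂ) : Eucl d → ℝ := fun x => ‖u x‖ ^ 2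

/-- The function `Re(u* v)`. -/
def reConjMul {d : ℕ} (u v : Eucl d → ℂ) : Eucl d → ℝ := fun x => (conj (u x) * v x).re

/-- The Hartree nonlinearity `(W ∗ |u|²) u`. -/
def hartree {d : ℕ} (W u : Eucl d → ℂ) : Eucl d → ℂ := fun x => conv W (absSq u) x * u x

/-- The function `(W ∗ |u|²) v + 2 (W ∗ Re(u* v)) u`. -/
def hartreeDeriv {d : ℕ} (W u v : Eucl d → ℂ) : Eucl d → ℂ := fun x =>
  conv W (absSq u) x * v x + 2 * conv W (reConjMul u v) x * u x

/-- The differentiability condition on a nonlinearity `B : H₁ → H₁` and a map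
`B' : H₁ → 𝓑(H₀)`, where `ι` is the inclusion of `H₁` in `H₀`: for `R, ε > 0` there are
`C, δ > 0` with `‖B'(u)‖ ≤ C` and `‖B(u + w) - B(u) - B'(u) w‖_{H₀} ≤ ε ‖w‖_{H₀}` whenever
`‖u‖_{H₁} ≤ R` and `‖w‖_{H₁} < δ`. The operators in `𝓑(H₀)` are bounded and real-linear. -/
def DerivCondition {H₁ H₀ : Type*} [NormedAddCommGroup H₁] [NormedSpace ℂ H₁]
    [NormedAddCommGroup H₀] [NormedSpace ℂ H₀] [NormedSpace ℝ H₀] [IsScalarTower ℝ ℂ H₀]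
    (ι : H₁ →ₗ[ℂ] H₀) (B : H₁ → H₁) (B' : H₁ → (H₀ →L[ℝ] H₀)) : Prop :=
  ∀ R > (0 : ℝ), ∀ ε > (0 : ℝ), ∃ C > (0 : ℝ), ∃ δ > (0 : ℝ),
    ∀ u w : H₁, ‖u‖ ≤ R → ‖w‖ < δ →
      ‖B' u‖ ≤ C ∧ ‖ι (B (u + w)) - ι (B u) - B' u (ι w)‖ ≤ ε * ‖ι w‖

end

/-! Since `p ≥ 2`, the large values of the `L^p` part of `W` form an `L²` function, so `W ∈ L^∞ +
L²`. By Hölder, convolution with `W` is defined at every point and maps `L¹ ∩ L²` boundedly into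
bounded functions (`ConvBound`). Everything else concerns the form `T(F, G, H) = (W ∗ (F G*)) H`
(`hartreeTri`). Its `L²` norm is controlled by the `L²` norm of any one chosen argument and the `L²
∩ L^∞` norms of the other two.

The Sobolev embedding, valid for `s > d/2`, gives `H^s ⊆ L² ∩ L^∞`. Then `B(u) = T(u,u,u)`, and
`B'(u)v` is the sum of the three terms with one `u` replaced by `v`. The remainder consists of the
terms with at least two `w`. One `w` is taken in `L²` and another supplies the small factor.

The harder point is `B(u) ∈ H^s` for fractional `s` and rough `W`. By Plancherel, `H^s` is described
by the integrals of `‖Δ^n f‖² t^(-1-2s)` over steps `t` along the coordinate axes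
(`L2.lintegral_eLpNorm_fwdDiff_iter_sq`). As `T` commutes with translations, differences obey a
Leibniz rule. After `3m` differences every term has an argument differenced at least `m` times;
measuring that one in `L²` gives `‖Δ^(3m) B(u)‖ ≤ C ‖Δ^m u‖`
(`ConvBound.eLpNorm_fwdDiff_iter_hartreeTri_le`). Choosing `m > s` finishes this part. -/

/-! ### Translations and differences under the Fourier transform -/

open FourierTransform in
theorem SchwartzMap.exists_fourier_eq_translate {d : ℕ} (h : Eucl d) (φ : 𝓢(Eucl d, ℂ)) :
    ∃ ψ : 𝓢(Eucl d, ℂ), (∀ ξ, ψ ξ = Real.fourierChar (inner ℝ h ξ) • φ ξ) ∧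
      ∀ x, 𝓕 ψ x = 𝓕 φ (x - h) := by
  -- Defining `ψ` on the Fourier side makes it Schwartz at once; only the pointwise modulation
  -- formula is left.
  refine ⟨𝓕⁻ (SchwartzMap.compSubConstCLM ℂ h (𝓕 φ)), fun ξ => ?_, fun x => by simp⟩
  have h1 := congrFun (VectorFourier.fourierIntegral_comp_add_right Real.fourierChar volume
    (-innerₗ (Eucl d)) (fun x => 𝓕 φ x) (-h)) ξ
  have h2 : ∀ f : 𝓢(Eucl d, ℂ), VectorFourier.fourierIntegral Real.fourierChar volume
    (-innerₗ (Eucl d)) f ξ = 𝓕⁻ f ξ := by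
    intro f
    rw [SchwartzMap.fourierInv_coe, Real.fourierInv_eq, VectorFourier.fourierIntegral]
    simp
  have h3 := h2 (SchwartzMap.compSubConstCLM ℂ h (𝓕 φ))
  rw [← h3]
  have h4 := h2 (𝓕 φ)
  rw [FourierTransform.fourierInv_fourier_eq] at h4
  rw [← h4]
  have h5 : ⇑(SchwartzMap.compSubConstCLM ℂ h (𝓕 φ)) = fun x => 𝓕 φ (x - h) := rfl
  rw [h5]
  simpa [Function.comp_def, ← sub_eq_add_neg] using h1

-- Both sides are compared as tempered distributions: the transform and the translation are moved
-- onto the test function, where the Schwartz version applies.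
open FourierTransform in
theorem L2.fourier_translate {d : ℕ} (h : Eucl d) (f : L2 d) :
    (𝓕 (Lp.compMeasurePreserving (· + h) (measurePreserving_add_right volume h) f) : L2 d)
      =ᵐ[volume] fun ξ => Real.fourierChar (inner ℝ h ξ) • (𝓕 f : L2 d) ξ := by
  have hm : MemLp (fun ξ => Real.fourierChar (inner ℝ h ξ) • (𝓕 f : L2 d) ξ) 2 volume := by
    refine MemLp.of_le (g := (𝓕 f : L2 d)) (Lp.memLp _) ?_ (by simp)
    refine AEStronglyMeasurable.smul ?_ (Lp.memLp (𝓕 f : L2 d)).1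
    have hc : Continuous fun ξ : Eucl d => inner ℝ h ξ := by fun_prop
    exact (continuous_subtype_val.comp
      (Real.continuous_fourierChar.comp hc)).aestronglyMeasurable
  suffices H : 𝓕 (Lp.compMeasurePreserving (· + h) (measurePreserving_add_right volume h) f)
      = hm.toLp _ by rw [H]; exact hm.coeFn_toLp
  apply L2.toTemperedDistribution_injective
  ext φ
  obtain ⟨ψ, hψ, hψ'⟩ := SchwartzMap.exists_fourier_eq_translate h φ
  rw [← Lp.fourier_toTemperedDistribution_eq, TemperedDistribution.fourier_apply,
    Lp.toTemperedDistribution_apply]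
  have e1 : ∫ x, (𝓕 φ) x • (Lp.compMeasurePreserving (· + h)
      (measurePreserving_add_right volume h) f) x = ∫ x, (𝓕 ψ) x • f x := by
    refine Eq.trans ?_ (integral_add_right_eq_self _ h)
    apply integral_congr_ae
    filter_upwards [Lp.coeFn_compMeasurePreserving f (measurePreserving_add_right volume h)]
      with x hx
    rw [hx, hψ', add_sub_cancel_right]; rfl
  rw [e1, ← Lp.toTemperedDistribution_apply, ← TemperedDistribution.fourier_apply,
    Lp.fourier_toTemperedDistribution_eq, Lp.toTemperedDistribution_apply,
    Lp.toTemperedDistribution_apply]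
  apply integral_congr_ae
  filter_upwards [hm.coeFn_toLp] with x hx
  rw [hx, hψ]
  simp only [Circle.smul_def, smul_eq_mul]; ring

open FourierTransform in
theorem L2.exists_fwdDiff_iter {d : ℕ} (h : Eucl d) (f : L2 d) (n : ℕ) :
    ∃ g : L2 d, g =ᵐ[volume] (fwdDiff h)^[n] f ∧
      (𝓕 g : L2 d) =ᵐ[volume]
        fun ξ => ((Real.fourierChar (inner ℝ h ξ) : ℂ) - 1) ^ n * (𝓕 f : L2 d) ξ := by
  induction n with
  | zero => exact ⟨f, by simp, by simp⟩
  | succ n ih =>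
    obtain ⟨g, hg, hg'⟩ := ih
    refine ⟨Lp.compMeasurePreserving (· + h) (measurePreserving_add_right volume h) g - g, ?_, ?_⟩
    · filter_upwards [Lp.coeFn_sub (Lp.compMeasurePreserving (· + h)
        (measurePreserving_add_right volume h) g) g, hg,
        Lp.coeFn_compMeasurePreserving g (measurePreserving_add_right volume h),
        (measurePreserving_add_right volume h).quasiMeasurePreserving.ae_eq_comp hg]
        with x h1 h2 h3 h4
      rw [h1, Pi.sub_apply, h3, h2, h4, Function.iterate_succ_apply']
      rfl
    · have hsub : ∀ a b : L2 d, 𝓕 (a - b) = 𝓕 a - 𝓕 b :=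
        map_sub (Lp.fourierTransformₗᵢ (Eucl d) ℂ)
      rw [hsub]
      filter_upwards [Lp.coeFn_sub (𝓕 (Lp.compMeasurePreserving (· + h)
        (measurePreserving_add_right volume h) g)) (𝓕 g : L2 d), hg',
        L2.fourier_translate h g] with ξ h1 h2 h3
      rw [h1, Pi.sub_apply, h3, h2]
      simp only [Circle.smul_def, smul_eq_mul]; ring

theorem L2.lintegral_enorm_sq {d : ℕ} (f : L2 d) :
    ∫⁻ x, ‖f x‖ₑ ^ 2 = eLpNorm f 2 volume ^ 2 := by
  rw [eLpNorm_eq_lintegral_rpow_enorm_toReal (by simp) (by simp), ← ENNReal.rpow_natCast,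
    ← ENNReal.rpow_mul]
  simp

open FourierTransform in
/-- Plancherel's formula for iterated differences. -/
theorem L2.eLpNorm_fwdDiff_iter_sq {d : ℕ} (h : Eucl d) (f : L2 d) (n : ℕ) :
    eLpNorm ((fwdDiff h)^[n] f) 2 volume ^ 2 =
      ∫⁻ ξ, ‖(Real.fourierChar (inner ℝ h ξ) : ℂ) - 1‖ₑ ^ (2 * n) * ‖(𝓕 f : L2 d) ξ‖ₑ ^ 2 := by
  obtain ⟨g, hg, hg'⟩ := L2.exists_fwdDiff_iter h f n
  have h1 : eLpNorm g 2 volume = eLpNorm (𝓕 g : L2 d) 2 volume := by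
    rw [← Lp.enorm_def, ← Lp.enorm_def, ← ofReal_norm, ← ofReal_norm, Lp.norm_fourier_eq]
  rw [← eLpNorm_congr_ae hg, h1, ← L2.lintegral_enorm_sq]
  apply lintegral_congr_ae
  filter_upwards [hg'] with ξ hξ
  rw [hξ, enorm_mul, enorm_pow, mul_pow, ← pow_mul, mul_comm n]

/-! ### Fourier description of the Sobolev space -/

theorem enorm_one_add_norm_sq_rpow {d : ℕ} (s : ℝ) (ξ : Eucl d) :
    ‖(((1 + ‖ξ‖ ^ 2) ^ s : ℝ) : ℂ)‖ₑ = ENNReal.ofReal ((1 + ‖ξ‖ ^ 2) ^ s) := by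
  rw [← ofReal_norm, Complex.norm_real, Real.norm_of_nonneg (by positivity)]

-- The Bessel relation is inverted on the Fourier side. For `s ≥ 0` the inverse weight is bounded,
-- so it acts on `L²` and the distributional identity becomes one between functions.
open FourierTransform in
theorem HSob.fourier_toL2 {d : ℕ} {s : ℝ} (hs : 0 ≤ s) (u : HSob d s) :
    (𝓕 (HSob.toL2 u) : L2 d) =ᵐ[volume]
      fun ξ => (((1 + ‖ξ‖ ^ 2) ^ (-s / 2) : ℝ) : ℂ) * (𝓕 (HSob.bessel u) : L2 d) ξ := by
  have hm : MemLp (fun ξ : Eucl d => (((1 + ‖ξ‖ ^ 2) ^ (-s / 2) : ℝ) : ℂ)) ∞ volume := by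
    refine memLp_top_of_bound (C := 1) (Continuous.aestronglyMeasurable ?_) ?_
    · have : (fun x : Eucl d ↦ (((1 + ‖x‖ ^ 2) ^ (-s / 2) : ℝ) : ℂ)).HasTemperateGrowth := by
        fun_prop
      exact this.1.continuous
    · filter_upwards with ξ
      rw [Complex.norm_real, Real.norm_of_nonneg (by positivity)]
      exact Real.rpow_le_one_of_one_le_of_nonpos (by simp) (by linarith)
  have h1 : (𝓕 (HSob.toL2 u) : L2 d) = ((hm.toLp _) • (𝓕 (HSob.bessel u) : L2 d) : L2 d) := by
    apply L2.toTemperedDistribution_injective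
    rw [MeasureTheory.Lp.toTemperedDistribution_smul_eq (by fun_prop),
      ← Lp.fourier_toTemperedDistribution_eq, ← Lp.fourier_toTemperedDistribution_eq,
      ← HSob.besselPotential_toL2, fourier_besselPotential_eq_smulLeftCLM_fourier_apply,
      smulLeftCLM_smulLeftCLM_apply (by fun_prop) (by fun_prop)]
    convert! (smulLeftCLM_const 1 (𝓕 (HSob.toL2 u : 𝓢'(Eucl d, ℂ)))).symm using 1
    · simp
    · congr
      ext x
      rw [Pi.mul_apply]
      norm_cast
      rw [← Real.rpow_add (by positivity)]
      ring_nf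
      simp
  rw [h1]
  filter_upwards [Lp.coeFn_lpSMul (r := 2) (hm.toLp _) (𝓕 (HSob.bessel u) : L2 d),
    hm.coeFn_toLp] with ξ h2 h3
  rw [h2, Pi.smul_apply', h3, smul_eq_mul]

open FourierTransform in
theorem HSob.lintegral_fourier_lt_top {d : ℕ} {s : ℝ} (hs : 0 ≤ s) (u : HSob d s) :
    ∫⁻ ξ, ENNReal.ofReal ((1 + ‖ξ‖ ^ 2) ^ s) * ‖(𝓕 (HSob.toL2 u) : L2 d) ξ‖ₑ ^ 2 < ∞ := by
  have : ∫⁻ ξ, ENNReal.ofReal ((1 + ‖ξ‖ ^ 2) ^ s) * ‖(𝓕 (HSob.toL2 u) : L2 d) ξ‖ₑ ^ 2 =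
      ∫⁻ ξ, ‖(𝓕 (HSob.bessel u) : L2 d) ξ‖ₑ ^ 2 := by
    apply lintegral_congr_ae
    filter_upwards [HSob.fourier_toL2 hs u] with ξ h
    rw [h, enorm_mul, mul_pow, ← mul_assoc, enorm_one_add_norm_sq_rpow,
      ← ENNReal.ofReal_pow (by positivity), ← ENNReal.ofReal_mul (by positivity),
      ← Real.rpow_mul_natCast (by positivity), ← Real.rpow_add (by positivity)]
    ring_nf
    simp
  rw [this, L2.lintegral_enorm_sq]
  exact ENNReal.pow_lt_top (Lp.memLp _).2

open FourierTransform in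
theorem L2.memSobolev_of_lintegral_fourier_lt_top {d : ℕ} {s : ℝ} (hs : 0 ≤ s) (f : L2 d)
    (hf : ∫⁻ ξ, ENNReal.ofReal ((1 + ‖ξ‖ ^ 2) ^ s) * ‖(𝓕 f : L2 d) ξ‖ₑ ^ 2 < ∞) :
    MemSobolev s 2 (f : 𝓢'(Eucl d, ℂ)) := by
  have hc : ∀ r : ℝ, Continuous (fun ξ : Eucl d => (((1 + ‖ξ‖ ^ 2) ^ r : ℝ) : ℂ)) := by
    intro r
    have : (fun x : Eucl d ↦ (((1 + ‖x‖ ^ 2) ^ r : ℝ) : ℂ)).HasTemperateGrowth := by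
      fun_prop
    exact this.1.continuous
  have hm : MemLp (fun ξ : Eucl d => (((1 + ‖ξ‖ ^ 2) ^ (-s / 2) : ℝ) : ℂ)) ∞ volume := by
    refine memLp_top_of_bound (C := 1) (hc _).aestronglyMeasurable ?_
    filter_upwards with ξ
    rw [Complex.norm_real, Real.norm_of_nonneg (by positivity)]
    exact Real.rpow_le_one_of_one_le_of_nonpos (by simp) (by linarith)
  have hg : MemLp (fun ξ : Eucl d => (((1 + ‖ξ‖ ^ 2) ^ (s / 2) : ℝ) : ℂ) * (𝓕 f : L2 d) ξ) 2
      volume := by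
    refine ⟨(hc _).aestronglyMeasurable.mul (Lp.memLp _).1, ?_⟩
    rw [eLpNorm_lt_top_iff_lintegral_rpow_enorm_lt_top (by simp) (by simp)]
    refine lt_of_eq_of_lt (lintegral_congr fun ξ => ?_) hf
    rw [ENNReal.toReal_ofNat, ENNReal.rpow_ofNat, enorm_mul, mul_pow, enorm_one_add_norm_sq_rpow,
      ← ENNReal.ofReal_pow (by positivity), ← Real.rpow_mul_natCast (by positivity)]
    ring_nf
  have h1 : (𝓕 f : L2 d) = ((hm.toLp _) • (hg.toLp _) : L2 d) := by
    apply Lp.ext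
    filter_upwards [Lp.coeFn_lpSMul (r := 2) (hm.toLp _) (hg.toLp _), hm.coeFn_toLp,
      hg.coeFn_toLp] with ξ h2 h3 h4
    rw [h2, Pi.smul_apply', h3, h4, smul_eq_mul, ← mul_assoc, ← Complex.ofReal_mul,
      ← Real.rpow_add (by positivity)]
    ring_nf
    simp
  rw [memSobolev_iff_exists_smulLeftCLM_fourier]
  refine ⟨hg.toLp _, ?_⟩
  have h2 := congrArg Lp.toTemperedDistribution h1
  rw [MeasureTheory.Lp.toTemperedDistribution_smul_eq (by fun_prop)] at h2
  rw [Lp.fourier_toTemperedDistribution_eq, h2,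
    smulLeftCLM_smulLeftCLM_apply (by fun_prop) (by fun_prop)]
  convert! (smulLeftCLM_const 1 (hg.toLp _ : 𝓢'(Eucl d, ℂ))) using 1
  · congr
    ext x
    rw [Pi.mul_apply]
    norm_cast
    rw [← Real.rpow_add (by positivity)]
    ring_nf
    simp
  · simp

/-! ### Sobolev embedding -/

-- If the transform is integrable, its inverse Fourier integral `g` is continuous and bounded by the
-- `L¹` norm. Testing against smooth compactly supported functions shows `f = g` almost everywhere.
open FourierTransform in
theorem L2.eLpNorm_top_le_eLpNorm_fourier {d : ℕ} (f : L2 d) :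
    eLpNorm f ∞ volume ≤ eLpNorm (𝓕 f : L2 d) 1 volume := by
  by_cases hv : eLpNorm (𝓕 f : L2 d) 1 volume = ∞
  · rw [hv]; exact le_top
  have hv1 : MemLp (𝓕 f : L2 d) 1 volume := ⟨(Lp.memLp _).1, lt_top_iff_ne_top.2 hv⟩
  have hvi : Integrable (𝓕 f : L2 d) volume := memLp_one_iff_integrable.1 hv1
  set g : Eucl d → ℂ := VectorFourier.fourierIntegral Real.fourierChar volume
    (-innerₗ (Eucl d)) (𝓕 f : L2 d) with hg
  have hL : Continuous fun p : Eucl d × Eucl d => (-innerₗ (Eucl d)) p.1 p.2 := by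
    simp only [LinearMap.neg_apply, innerₗ_apply_apply]
    fun_prop
  have hgc : Continuous g :=
    VectorFourier.fourierIntegral_continuous Real.continuous_fourierChar hL hvi
  have hfg : f =ᵐ[volume] g := by
    refine ae_eq_of_integral_contDiff_smul_eq ((Lp.memLp f).locallyIntegrable (by norm_num))
      hgc.locallyIntegrable ?_
    intro φ φ_smooth φ_cpt
    have h1 : HasCompactSupport (Complex.ofRealCLM ∘ φ) := φ_cpt.comp_left rfl
    have h2 : ContDiff ℝ (⊤ : ℕ∞) (Complex.ofRealCLM ∘ φ) := by fun_prop
    set ψ : 𝓢(Eucl d, ℂ) := h1.toSchwartzMap h2 with hψ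
    have hψφ : ∀ x, ψ x = (φ x : ℂ) := fun x => rfl
    calc ∫ x, φ x • f x = ∫ x, ψ x • f x := by simp [hψφ]
      _ = (f : 𝓢'(Eucl d, ℂ)) ψ := by rw [Lp.toTemperedDistribution_apply]
      _ = (𝓕 (f : 𝓢'(Eucl d, ℂ))) (𝓕⁻ ψ) := by
        rw [TemperedDistribution.fourier_apply, FourierTransform.fourier_fourierInv_eq]
      _ = ∫ ξ, (𝓕⁻ ψ) ξ • (𝓕 f : L2 d) ξ := by
        rw [Lp.fourier_toTemperedDistribution_eq, Lp.toTemperedDistribution_apply]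
      _ = ∫ x, ψ x • g x := by
        have h3 := VectorFourier.integral_fourierIntegral_smul_eq_flip (μ := volume) (ν := volume)
          Real.continuous_fourierChar hL ψ.integrable hvi
        have h4 : (-innerₗ (Eucl d)).flip = -innerₗ (Eucl d) := by
          ext x y; simp [real_inner_comm]
        rw [h4] at h3
        rw [← h3]
        congr with ξ
        rw [SchwartzMap.fourierInv_coe, Real.fourierInv_eq, VectorFourier.fourierIntegral]
        simp
      _ = ∫ x, φ x • g x := by simp [hψφ]
  rw [eLpNorm_congr_ae hfg]
  refine (eLpNorm_le_of_ae_bound (C := ∫ ξ, ‖(𝓕 f : L2 d) ξ‖) ?_).trans ?_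
  · filter_upwards with x
    exact VectorFourier.norm_fourierIntegral_le_integral_norm _ _ _ _ _
  · rw [eLpNorm_one_eq_lintegral_enorm, ofReal_integral_norm_eq_lintegral_enorm hvi]
    simp

open FourierTransform in
/-- The Sobolev embedding `H^s ⊆ L^∞` for `s > d / 2`. -/
theorem HSob.exists_eLpNorm_top_le {d : ℕ} {s : ℝ} (hs : (d : ℝ) / 2 < s) :
    ∃ C : ℝ, 0 < C ∧ ∀ u : HSob d s,
      eLpNorm (HSob.toL2 u) ∞ volume ≤ ENNReal.ofReal (C * ‖u‖) := by
  have hs0 : 0 ≤ s := le_trans (by positivity) hs.le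
  -- The condition `s > d/2` enters here; Cauchy–Schwarz against this weight then bounds the `L¹`
  -- norm of the transform.
  have hw : MemLp (fun x : Eucl d ↦ (((1 + ‖x‖ ^ 2) ^ (-s / 2) : ℝ) : ℂ)) 2 volume := by
    constructor
    · have : (fun x : Eucl d ↦ (((1 + ‖x‖ ^ 2) ^ (-s / 2) : ℝ) : ℂ)).HasTemperateGrowth := by
        fun_prop
      exact this.1.continuous.aestronglyMeasurable
    · rw [eLpNorm_lt_top_iff_lintegral_rpow_enorm_lt_top (by norm_num) (by norm_num)]
      have hs2 : (Module.finrank ℝ (Eucl d) : ℝ) < 2 * s := by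
        rw [finrank_euclideanSpace_fin]; linarith
      have hi := (integrable_rpow_neg_one_add_norm_sq (μ := (volume : Measure (Eucl d))) hs2)
      refine lt_of_eq_of_lt (lintegral_congr fun ξ => ?_) hi.lintegral_lt_top
      rw [ENNReal.toReal_ofNat, ENNReal.rpow_ofNat, enorm_one_add_norm_sq_rpow,
        ← ENNReal.ofReal_pow (by positivity), ← Real.rpow_mul_natCast (by positivity)]
      ring_nf
  set A := eLpNorm (fun x : Eucl d ↦ (((1 + ‖x‖ ^ 2) ^ (-s / 2) : ℝ) : ℂ)) 2 volume with hA
  refine ⟨A.toReal + 1, by positivity, fun u => ?_⟩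
  refine (L2.eLpNorm_top_le_eLpNorm_fourier _).trans ?_
  rw [eLpNorm_congr_ae (HSob.fourier_toL2 hs0 u)]
  refine (eLpNorm_smul_le_mul_eLpNorm (p := 2) (q := 2) (r := 1)
    (Lp.memLp (𝓕 (HSob.bessel u) : L2 d)).1 hw.1).trans ?_
  rw [← Lp.enorm_def, ← ofReal_norm, Lp.norm_fourier_eq, ← HSob.norm_eq,
    ENNReal.ofReal_mul (by positivity)]
  refine mul_le_mul_left (ENNReal.ofReal_toReal hw.2.ne).ge _ |>.trans ?_
  gcongr
  exact le_add_of_le_of_nonneg le_rfl zero_le_one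

open FourierTransform in
theorem HSob.norm_toL2_le {d : ℕ} {s : ℝ} (hs : 0 ≤ s) (u : HSob d s) :
    ‖HSob.toL2 u‖ ≤ ‖u‖ := by
  rw [HSob.norm_eq, ← Lp.norm_fourier_eq, ← Lp.norm_fourier_eq (HSob.bessel u)]
  apply Lp.norm_le_norm_of_ae_le
  filter_upwards [HSob.fourier_toL2 hs u] with ξ h
  rw [h, norm_mul, Complex.norm_real, Real.norm_of_nonneg (by positivity)]
  exact mul_le_of_le_one_left (norm_nonneg _)
    (Real.rpow_le_one_of_one_le_of_nonpos (by simp) (by linarith))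

/-! ### Sobolev regularity through iterated differences -/

/-- The symbol `∫ |e^{2πitx} - 1|^{2n} t^{-1-2s} dt` over `t > 0`. -/
noncomputable def diffSymbol (n : ℕ) (s x : ℝ) : ℝ≥0∞ :=
  ∫⁻ t in Set.Ioi (0 : ℝ), ‖(Real.fourierChar (t * x) : ℂ) - 1‖ₑ ^ (2 * n) *
    ENNReal.ofReal (t ^ (-1 - 2 * s))

theorem continuous_fourierChar_coe : Continuous fun x : ℝ => (Real.fourierChar x : ℂ) :=
  continuous_subtype_val.comp Real.continuous_fourierChar

theorem enorm_fourierChar_neg_sub_one (x : ℝ) :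
    ‖(Real.fourierChar (-x) : ℂ) - 1‖ₑ = ‖(Real.fourierChar x : ℂ) - 1‖ₑ := by
  rw [← ofReal_norm, ← ofReal_norm, AddChar.map_neg_eq_inv, Circle.coe_inv_eq_conj,
    ← RCLike.norm_conj]
  simp

theorem diffSymbol_neg (n : ℕ) (s x : ℝ) : diffSymbol n s (-x) = diffSymbol n s x := by
  simp only [diffSymbol, mul_neg, enorm_fourierChar_neg_sub_one]

theorem diffSymbol_zero {n : ℕ} (hn : n ≠ 0) (s : ℝ) : diffSymbol n s 0 = 0 := by
  simp [diffSymbol, hn]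

/-- Homogeneity, by the substitution `t ↦ t x`. -/
theorem diffSymbol_of_pos (n : ℕ) (s : ℝ) {x : ℝ} (hx : 0 < x) :
    diffSymbol n s x = ENNReal.ofReal (x ^ (2 * s)) * diffSymbol n s 1 := by
  have h1 : diffSymbol n s 1 = ENNReal.ofReal (x ^ (-(2 * s))) * diffSymbol n s x := by
    have hme : MeasurableEmbedding fun y : ℝ => y * x :=
      (Homeomorph.mulRight₀ x hx.ne').measurableEmbedding
    unfold diffSymbol
    rw [← lintegral_indicator measurableSet_Ioi, ← lintegral_indicator measurableSet_Ioi]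
    conv_lhs => rw [← Real.smul_map_volume_mul_right hx.ne']
    rw [lintegral_smul_measure,
      hme.lintegral_map,
      ← lintegral_const_mul' _ _ ENNReal.ofReal_ne_top, smul_eq_mul,
      ← lintegral_const_mul' _ _ ENNReal.ofReal_ne_top]
    refine lintegral_congr fun t => ?_
    rcases le_or_gt t 0 with ht | ht
    · have ht' : t * x ≤ 0 := mul_nonpos_of_nonpos_of_nonneg ht hx.le
      simp [Set.indicator, ht.not_gt, ht'.not_gt]
    · have ht' : 0 < t * x := mul_pos ht hx
      simp only [Set.indicator, Set.mem_Ioi, ht, ht', if_true, mul_one]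
      rw [mul_left_comm, mul_left_comm (ENNReal.ofReal (x ^ _)), abs_of_pos hx,
        ← ENNReal.ofReal_mul hx.le, ← ENNReal.ofReal_mul (by positivity),
        Real.mul_rpow ht.le hx.le]
      congr 2
      rw [mul_left_comm, mul_comm (x ^ (-(2 * s)))]
      congr 1
      nth_rw 1 [← Real.rpow_one x]
      rw [← Real.rpow_add hx]
      congr 1; ring
  rw [h1, ← mul_assoc, ← ENNReal.ofReal_mul (by positivity), ← Real.rpow_add hx]
  simp

theorem diffSymbol_eq {n : ℕ} (hn : n ≠ 0) {s : ℝ} (hs : 0 < s) (x : ℝ) :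
    diffSymbol n s x = ENNReal.ofReal (|x| ^ (2 * s)) * diffSymbol n s 1 := by
  rcases lt_trichotomy x 0 with hx | hx | hx
  · rw [← diffSymbol_neg, diffSymbol_of_pos n s (neg_pos.2 hx), abs_of_neg hx]
  · rw [hx, diffSymbol_zero hn, abs_zero, Real.zero_rpow (by positivity)]
    simp
  · rw [diffSymbol_of_pos n s hx, abs_of_pos hx]

theorem norm_fourierChar_sub_one_le (t : ℝ) :
    ‖(Real.fourierChar t : ℂ) - 1‖ ≤ 2 * Real.pi * |t| := by
  rw [Real.fourierChar_apply, mul_comm]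
  refine (Real.norm_exp_I_mul_ofReal_sub_one_le).trans ?_
  simp [abs_of_pos Real.pi_pos]

theorem norm_fourierChar_sub_one_le_two (t : ℝ) :
    ‖(Real.fourierChar t : ℂ) - 1‖ ≤ 2 := by
  refine (norm_sub_le _ _).trans ?_
  rw [Circle.norm_coe]; norm_num

/-- Near `0` the integrand is `O(t^(2n-1-2s))`, integrable because `n > s`. Beyond `1` the character
factor is bounded and `s > 0` gives decay. -/
theorem diffSymbol_one_lt_top {n : ℕ} {s : ℝ} (hs : 0 < s) (hn : s < n) :
    diffSymbol n s 1 < ∞ := by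
  have h0 : diffSymbol n s 1 ≤
      (∫⁻ t in Set.Ioc (0 : ℝ) 1, ENNReal.ofReal ((2 * Real.pi) ^ (2 * n) *
        t ^ (2 * n - 1 - 2 * s : ℝ))) +
      ∫⁻ t in Set.Ioi (1 : ℝ), ENNReal.ofReal (2 ^ (2 * n) * t ^ (-1 - 2 * s)) := by
    rw [diffSymbol, ← Set.Ioc_union_Ioi_eq_Ioi zero_le_one]
    refine (lintegral_union_le _ _ _).trans (add_le_add ?_ ?_)
    · refine setLIntegral_mono' measurableSet_Ioc fun t ht => ?_
      rw [← ofReal_norm, ← ENNReal.ofReal_pow (norm_nonneg _),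
        ← ENNReal.ofReal_mul (by positivity)]
      refine ENNReal.ofReal_le_ofReal ?_
      have h1 := norm_fourierChar_sub_one_le (t * 1)
      rw [mul_one, abs_of_pos ht.1] at h1
      rw [mul_one]
      calc _ ≤ (2 * Real.pi * t) ^ (2 * n) * t ^ (-1 - 2 * s) :=
            mul_le_mul_of_nonneg_right (pow_le_pow_left₀ (norm_nonneg _) h1 _)
              (Real.rpow_nonneg ht.1.le _)
        _ = _ := by
            rw [mul_pow, mul_assoc, ← Real.rpow_natCast t, ← Real.rpow_add ht.1]
            congr 2; push_cast; ring
    · refine setLIntegral_mono' measurableSet_Ioi fun t ht => ?_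
      have ht0 : (0 : ℝ) < t := zero_lt_one.trans ht
      rw [← ofReal_norm, ← ENNReal.ofReal_pow (norm_nonneg _),
        ← ENNReal.ofReal_mul (by positivity)]
      refine ENNReal.ofReal_le_ofReal ?_
      exact mul_le_mul_of_nonneg_right (pow_le_pow_left₀ (norm_nonneg _)
        (norm_fourierChar_sub_one_le_two _) _) (Real.rpow_nonneg ht0.le _)
  refine h0.trans_lt (ENNReal.add_lt_top.2 ⟨?_, ?_⟩)
  · have h1 : IntervalIntegrable (fun t : ℝ => t ^ (2 * n - 1 - 2 * s : ℝ)) volume 0 1 :=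
      intervalIntegral.intervalIntegrable_rpow' (by linarith)
    rw [intervalIntegrable_iff_integrableOn_Ioc_of_le zero_le_one] at h1
    exact (h1.const_mul _).lintegral_lt_top
  · have h1 : IntegrableOn (fun t : ℝ => t ^ (-1 - 2 * s)) (Set.Ioi 1) :=
      integrableOn_Ioi_rpow_of_lt (by linarith) zero_lt_one
    exact (h1.const_mul _).lintegral_lt_top

/-- The integrand vanishes on `t > 0` only at integers, hence nowhere on `(0, 1)`. -/
theorem diffSymbol_one_pos (n : ℕ) (s : ℝ) : 0 < diffSymbol n s 1 := by
  have hmeas : Measurable fun t : ℝ => ‖(Real.fourierChar (t * 1) : ℂ) - 1‖ₑ ^ (2 * n) *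
      ENNReal.ofReal (t ^ (-1 - 2 * s)) := by
    have h1 : Measurable fun t : ℝ => (Real.fourierChar (t * 1) : ℂ) :=
      (continuous_fourierChar_coe.comp (continuous_mul_const 1)).measurable
    fun_prop
  rw [diffSymbol, setLIntegral_pos_iff hmeas]
  refine lt_of_lt_of_le (b := volume (Set.Ioo (0 : ℝ) 1)) (by simp) (measure_mono fun t ht => ?_)
  refine ⟨?_, ht.1⟩
  have h1 : (Real.fourierChar (t * 1) : ℂ) - 1 ≠ 0 := by
    rw [mul_one, sub_ne_zero, Real.fourierChar_apply]
    intro h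
    obtain ⟨k, hk⟩ := Complex.exp_eq_one_iff.1 h
    have h2 : ((2 * Real.pi * t : ℝ) : ℂ) = ((k * (2 * Real.pi) : ℝ) : ℂ) := by
      apply mul_right_cancel₀ Complex.I_ne_zero
      rw [hk]; push_cast; ring
    have h3 : t = k := by
      have := Complex.ofReal_injective h2
      have hpi := Real.pi_pos
      apply mul_left_cancel₀ (mul_ne_zero two_ne_zero hpi.ne')
      rw [this]; ring
    have h4 := ht.1
    have h5 := ht.2
    rw [h3] at h4 h5
    norm_cast at h4 h5
    omega
  have h2 : (0 : ℝ) < t ^ (-1 - 2 * s) := Real.rpow_pos_of_pos ht.1 _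
  exact mul_ne_zero (pow_ne_zero _ (enorm_ne_zero.2 h1)) (ENNReal.ofReal_pos.2 h2).ne'

-- Plancherel for each step `t`, then Tonelli: the inner integral over `t` is the symbol at `ξ j`, a
-- constant times `|ξ j|^(2s)`.
open FourierTransform in
theorem L2.lintegral_eLpNorm_fwdDiff_iter_sq {d : ℕ} (f : L2 d) {n : ℕ} (hn : n ≠ 0) {s : ℝ}
    (hs : 0 < s) (j : Fin d) :
    ∫⁻ t in Set.Ioi (0 : ℝ), eLpNorm ((fwdDiff (EuclideanSpace.single j t : Eucl d))^[n] f) 2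
      volume ^ 2 * ENNReal.ofReal (t ^ (-1 - 2 * s)) =
    (∫⁻ ξ, ENNReal.ofReal (|ξ j| ^ (2 * s)) * ‖(𝓕 f : L2 d) ξ‖ₑ ^ 2) * diffSymbol n s 1 := by
  have hF : Measurable fun q : ℝ × Eucl d => ‖(Real.fourierChar (q.1 * q.2 j) : ℂ) - 1‖ₑ := by
    have h1 : Continuous fun q : ℝ × Eucl d => q.1 * q.2 j := by fun_prop
    have h2 : Measurable fun q : ℝ × Eucl d => (Real.fourierChar (q.1 * q.2 j) : ℂ) :=
      (continuous_fourierChar_coe.comp h1).measurable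
    fun_prop
  have hf : AEMeasurable (fun ξ => ‖(𝓕 f : L2 d) ξ‖ₑ ^ 2) volume :=
    (Lp.memLp (𝓕 f : L2 d)).1.enorm.pow_const 2
  calc _ = ∫⁻ t in Set.Ioi (0 : ℝ), ∫⁻ ξ, ‖(Real.fourierChar (t * ξ j) : ℂ) - 1‖ₑ ^ (2 * n) *
          ‖(𝓕 f : L2 d) ξ‖ₑ ^ 2 * ENNReal.ofReal (t ^ (-1 - 2 * s)) := by
        refine lintegral_congr fun t => ?_
        rw [L2.eLpNorm_fwdDiff_iter_sq, lintegral_mul_const' _ _ ENNReal.ofReal_ne_top]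
        simp [EuclideanSpace.inner_single_left]
    _ = ∫⁻ ξ, ∫⁻ t in Set.Ioi (0 : ℝ), ‖(Real.fourierChar (t * ξ j) : ℂ) - 1‖ₑ ^ (2 * n) *
          ‖(𝓕 f : L2 d) ξ‖ₑ ^ 2 * ENNReal.ofReal (t ^ (-1 - 2 * s)) := by
        refine lintegral_lintegral_swap ?_
        refine ((hF.pow_const _).aemeasurable.mul hf.comp_snd).mul ?_
        exact Measurable.aemeasurable (by fun_prop)
    _ = ∫⁻ ξ, (ENNReal.ofReal (|ξ j| ^ (2 * s)) * ‖(𝓕 f : L2 d) ξ‖ₑ ^ 2) *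
          diffSymbol n s 1 := by
        refine lintegral_congr fun ξ => ?_
        rw [mul_right_comm, ← diffSymbol_eq hn hs, diffSymbol,
          ← lintegral_mul_const' _ _ (by finiteness)]
        refine lintegral_congr fun t => ?_
        ring
    _ = _ := by
        rw [lintegral_mul_const'' _ ?_]
        refine AEMeasurable.mul ?_ hf
        exact Measurable.aemeasurable (by fun_prop)

theorem HSob.lintegral_eLpNorm_fwdDiff_iter_lt_top {d : ℕ} {s : ℝ} (hs : 0 < s) (u : HSob d s)
    {n : ℕ} (hn : s < n) (j : Fin d) :
    ∫⁻ t in Set.Ioi (0 : ℝ), eLpNorm ((fwdDiff (EuclideanSpace.single j t : Eucl d))^[n]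
      (HSob.toL2 u)) 2 volume ^ 2 * ENNReal.ofReal (t ^ (-1 - 2 * s)) < ∞ := by
  have hn0 : n ≠ 0 := by
    rintro rfl
    exact (hs.trans hn).ne' (by simp)
  rw [L2.lintegral_eLpNorm_fwdDiff_iter_sq _ hn0 hs]
  refine ENNReal.mul_lt_top (lt_of_le_of_lt (lintegral_mono fun ξ => ?_)
    (HSob.lintegral_fourier_lt_top hs.le u)) (diffSymbol_one_lt_top hs hn)
  gcongr
  rw [Real.rpow_mul (abs_nonneg _), Real.rpow_ofNat, sq_abs]
  gcongr
  have h1 := EuclideanSpace.norm_sq_eq ξ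
  have h2 := Finset.single_le_sum (f := fun i => ‖ξ i‖ ^ 2) (fun i _ => sq_nonneg _)
    (Finset.mem_univ j)
  simp only [Real.norm_eq_abs, sq_abs] at h1 h2
  linarith

/-- Each `(ξ j)²` and `1` is at most `S^(1/s)`, where `S` is the bracket on the right; adding these
`d + 1` bounds avoids convexity and treats all `s > 0` alike. -/
theorem one_add_norm_sq_rpow_le {d : ℕ} {s : ℝ} (hs : 0 < s) (ξ : Eucl d) :
    (1 + ‖ξ‖ ^ 2) ^ s ≤ (d + 1) ^ s * (1 + ∑ j, |ξ j| ^ (2 * s)) := by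
  set S := 1 + ∑ j, |ξ j| ^ (2 * s) with hS
  have h0 : ∀ j, 0 ≤ |ξ j| ^ (2 * s) := fun j => by positivity
  have hS1 : 1 ≤ S := le_add_of_nonneg_right (Finset.sum_nonneg fun j _ => h0 j)
  have hj : ∀ j, (ξ j) ^ 2 ≤ S ^ s⁻¹ := by
    intro j
    have h1 : |ξ j| ^ (2 * s) ≤ S := by
      have := Finset.single_le_sum (f := fun i => |ξ i| ^ (2 * s)) (fun i _ => h0 i)
        (Finset.mem_univ j)
      simp only at this
      linarith
    have h2 := Real.rpow_le_rpow (h0 j) h1 (inv_nonneg.2 hs.le)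
    rwa [← Real.rpow_mul (abs_nonneg _), mul_assoc, mul_inv_cancel₀ hs.ne', mul_one,
      Real.rpow_ofNat, sq_abs] at h2
  have h1 : 1 + ‖ξ‖ ^ 2 ≤ (d + 1) * S ^ s⁻¹ := by
    have h2 : ‖ξ‖ ^ 2 ≤ d * S ^ s⁻¹ := by
      rw [EuclideanSpace.norm_sq_eq]
      simp only [Real.norm_eq_abs, sq_abs]
      refine (Finset.sum_le_sum fun j _ => hj j).trans ?_
      simp
    have h3 : 1 ≤ S ^ s⁻¹ := Real.one_le_rpow hS1 (inv_nonneg.2 hs.le)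
    linarith
  refine (Real.rpow_le_rpow (by positivity) h1 hs.le).trans ?_
  rw [Real.mul_rpow (by positivity) (by positivity), ← Real.rpow_mul (by positivity),
    inv_mul_cancel₀ hs.ne', Real.rpow_one]

-- Only positivity of the symbol constant is used, so `n ≠ 0` suffices and `n > s` is not needed.
-- The coordinate directions control the homogeneous weight, and `f ∈ L²` handles the constant term.
open FourierTransform in
theorem L2.memSobolev_of_lintegral_fwdDiff_iter_lt_top {d : ℕ} {s : ℝ} (hs : 0 < s) (f : L2 d)
    {n : ℕ} (hn : n ≠ 0)
    (hf : ∀ j, ∫⁻ t in Set.Ioi (0 : ℝ), eLpNorm ((fwdDiff (EuclideanSpace.single j t :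
      Eucl d))^[n] f) 2 volume ^ 2 * ENNReal.ofReal (t ^ (-1 - 2 * s)) < ∞) :
    MemSobolev s 2 (f : 𝓢'(Eucl d, ℂ)) := by
  apply L2.memSobolev_of_lintegral_fourier_lt_top hs.le
  have hF : AEMeasurable (fun ξ => ‖(𝓕 f : L2 d) ξ‖ₑ ^ 2) volume :=
    (Lp.memLp (𝓕 f : L2 d)).1.enorm.pow_const 2
  have hj : ∀ j, ∫⁻ ξ, ENNReal.ofReal (|ξ j| ^ (2 * s)) * ‖(𝓕 f : L2 d) ξ‖ₑ ^ 2 < ∞ := by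
    intro j
    have h1 := hf j
    rw [L2.lintegral_eLpNorm_fwdDiff_iter_sq f hn hs j] at h1
    exact ENNReal.lt_top_of_mul_ne_top_left h1.ne (diffSymbol_one_pos n s).ne'
  calc _ ≤ ∫⁻ ξ, ENNReal.ofReal ((d + 1) ^ s) * (‖(𝓕 f : L2 d) ξ‖ₑ ^ 2 +
        ∑ j, ENNReal.ofReal (|ξ j| ^ (2 * s)) * ‖(𝓕 f : L2 d) ξ‖ₑ ^ 2) := by
        refine lintegral_mono fun ξ => ?_
        refine (mul_le_mul_left (ENNReal.ofReal_le_ofReal (one_add_norm_sq_rpow_le hs ξ)) _).trans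
          (le_of_eq ?_)
        rw [ENNReal.ofReal_mul (by positivity), ENNReal.ofReal_add zero_le_one
          (Finset.sum_nonneg fun j _ => by positivity), ENNReal.ofReal_one,
          ENNReal.ofReal_sum_of_nonneg fun j _ => by positivity, mul_assoc, add_mul, one_mul,
          Finset.sum_mul]
    _ = ENNReal.ofReal ((d + 1) ^ s) * (∫⁻ ξ, ‖(𝓕 f : L2 d) ξ‖ₑ ^ 2 +
        ∑ j, ENNReal.ofReal (|ξ j| ^ (2 * s)) * ‖(𝓕 f : L2 d) ξ‖ₑ ^ 2) :=
        lintegral_const_mul' _ _ ENNReal.ofReal_ne_top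
    _ < ∞ := by
        rw [lintegral_add_left' hF, lintegral_finsetSum' _ fun j _ => ?_]
        · refine ENNReal.mul_lt_top ENNReal.ofReal_lt_top (ENNReal.add_lt_top.2 ⟨?_, ?_⟩)
          · rw [L2.lintegral_enorm_sq]
            exact ENNReal.pow_lt_top (Lp.memLp _).2
          · exact ENNReal.sum_lt_top.2 fun j _ => hj j
        · refine AEMeasurable.mul ?_ hF
          exact Measurable.aemeasurable (by fun_prop)

/-! ### Convolution with the potential -/

theorem eLpNorm_mul_le_of_holderTriple {d : ℕ} {f g : Eucl d → ℂ} {p q r : ℝ≥0∞}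
    [ENNReal.HolderTriple p q r] (hf : AEStronglyMeasurable f volume)
    (hg : AEStronglyMeasurable g volume) :
    eLpNorm (fun x => f x * g x) r volume ≤ eLpNorm f p volume * eLpNorm g q volume := by
  have h := eLpNorm_smul_le_mul_eLpNorm (p := p) (q := q) (r := r) hg hf
  exact h

/-- Convolution with `W` is a bounded operator `L¹ ∩ L² → L^∞` of norm at most `K`. -/
structure ConvBound {d : ℕ} (W : Eucl d → ℂ) (K : ℝ≥0∞) : Prop where
  aesm : AEStronglyMeasurable W volume
  ne_top : K ≠ ∞
  exists_conv : ∀ g : Eucl d → ℂ, MemLp g 1 volume → MemLp g 2 volume →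
    ConvolutionExists W g (ContinuousLinearMap.mul ℂ ℂ) volume
  enorm_le : ∀ g : Eucl d → ℂ, MemLp g 1 volume → MemLp g 2 volume → ∀ x,
    ‖(W ⋆[ContinuousLinearMap.mul ℂ ℂ, volume] g) x‖ₑ ≤
      K * (eLpNorm g 1 volume + eLpNorm g 2 volume)

/-- Cut at height `1`. For `p < ∞` the set `|W| ≥ 1` has finite measure, on which `L^p ⊆ L²`; off it
the function is bounded. -/
theorem MemLp.exists_top_add_two {d : ℕ} {W : Eucl d → ℂ} {p : ℝ≥0∞} (hp : 2 ≤ p)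
    (hW : MemLp W p volume) :
    ∃ A B : Eucl d → ℂ, MemLp A ∞ volume ∧ MemLp B 2 volume ∧ W =ᵐ[volume] A + B := by
  by_cases hp' : p = ∞
  · exact ⟨W, 0, hp' ▸ hW, MemLp.zero, by simp⟩
  set V := hW.1.mk W with hV
  have hWV : W =ᵐ[volume] V := hW.1.ae_eq_mk
  have hVm : StronglyMeasurable V := hW.1.stronglyMeasurable_mk
  have hVp : MemLp V p volume := (memLp_congr_ae hWV).1 hW
  set S : Set (Eucl d) := {x | (1 : ℝ) ≤ ‖V x‖} with hS
  have hSm : MeasurableSet S := measurableSet_le measurable_const hVm.norm.measurable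
  have hSfin : volume S < ∞ := by
    have := hVp.meas_ge_lt_top (ε := 1) (by positivity) hp' one_ne_zero
    simpa [hS, ← NNReal.coe_le_coe] using this
  refine ⟨Sᶜ.indicator V, S.indicator V, ?_, ?_, ?_⟩
  · refine memLp_top_of_bound (C := 1) (hVm.indicator hSm.compl).aestronglyMeasurable ?_
    filter_upwards with x
    by_cases hx : x ∈ S
    · simp [hx]
    · simpa [hx] using (not_le.1 hx).le
  · rw [memLp_indicator_iff_restrict hSm]
    have : IsFiniteMeasure (volume.restrict S) := ⟨by simpa using hSfin⟩
    exact (hVp.restrict S).mono_exponent hp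
  · rw [Set.indicator_compl_add_self]
    exact hWV

theorem MemLpAdd.exists_top_two {d : ℕ} {W : Eucl d → ℂ} {p : ℝ≥0∞} (hp : 2 ≤ p)
    (hW : MemLpAdd W ∞ p) : MemLpAdd W ∞ 2 := by
  obtain ⟨W₁, W₂, h1, h2, h3⟩ := hW
  obtain ⟨A, B, hA, hB, hAB⟩ := MemLp.exists_top_add_two hp h2
  refine ⟨W₁ + A, B, h1.add hA, hB, h3.trans ?_⟩
  filter_upwards [hAB] with x hx
  simp [hx, add_assoc]

/-- Hölder at each fixed `x`, pairing `L^∞` with `L¹` and `L²` with `L²`; `t ↦ x - t` preserves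
measure. -/
theorem MemLpAdd.exists_convBound {d : ℕ} {W : Eucl d → ℂ} (hW : MemLpAdd W ∞ 2) :
    ∃ K, ConvBound W K := by
  obtain ⟨W₁, W₂, h1, h2, h3⟩ := hW
  have hmp : ∀ x : Eucl d, MeasurePreserving (fun t => x - t) volume volume :=
    fun x => Measure.measurePreserving_sub_left volume x
  have hae : ∀ (g : Eucl d → ℂ) (x : Eucl d), (fun t => W t * g (x - t)) =ᵐ[volume]
      (fun t => W₁ t * g (x - t)) + fun t => W₂ t * g (x - t) := by
    intro g x
    filter_upwards [h3] with t ht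
    simp [ht, add_mul]
  have hI1 : ∀ (g : Eucl d → ℂ) (x : Eucl d), MemLp g 1 volume →
      MemLp (fun t => W₁ t * g (x - t)) 1 volume := fun g x hg =>
    (hg.comp_measurePreserving (hmp x)).mul h1
  have hI2 : ∀ (g : Eucl d → ℂ) (x : Eucl d), MemLp g 2 volume →
      MemLp (fun t => W₂ t * g (x - t)) 1 volume := fun g x hg =>
    (hg.comp_measurePreserving (hmp x)).mul h2
  refine ⟨eLpNorm W₁ ∞ volume + eLpNorm W₂ 2 volume,
    ⟨(h1.1.add h2.1).congr h3.symm, (ENNReal.add_lt_top.2 ⟨h1.2, h2.2⟩).ne, ?_, ?_⟩⟩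
  · intro g hg1 hg2 x
    change Integrable (fun t => W t * g (x - t)) volume
    rw [integrable_congr (hae g x)]
    exact (memLp_one_iff_integrable.1 (hI1 g x hg1)).add (memLp_one_iff_integrable.1 (hI2 g x hg2))
  · intro g hg1 hg2 x
    have e1 : (W ⋆[ContinuousLinearMap.mul ℂ ℂ, volume] g) x = ∫ t, W t * g (x - t) := rfl
    rw [e1]
    refine (enorm_integral_le_lintegral_enorm _).trans ?_
    rw [← eLpNorm_one_eq_lintegral_enorm, eLpNorm_congr_ae (hae g x)]
    refine (eLpNorm_add_le (hI1 g x hg1).1 (hI2 g x hg2).1 le_rfl).trans ?_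
    have e2 : eLpNorm (fun t => W₁ t * g (x - t)) 1 volume ≤
        eLpNorm W₁ ∞ volume * eLpNorm g 1 volume := by
      rw [← eLpNorm_comp_measurePreserving hg1.1 (hmp x)]
      exact eLpNorm_mul_le_of_holderTriple (g := g ∘ fun t => x - t) h1.1
        (hg1.comp_measurePreserving (hmp x)).1
    have e3 : eLpNorm (fun t => W₂ t * g (x - t)) 1 volume ≤
        eLpNorm W₂ 2 volume * eLpNorm g 2 volume := by
      rw [← eLpNorm_comp_measurePreserving hg2.1 (hmp x)]
      exact eLpNorm_mul_le_of_holderTriple (g := g ∘ fun t => x - t) h2.1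
        (hg2.comp_measurePreserving (hmp x)).1
    refine (add_le_add e2 e3).trans ?_
    rw [add_mul]
    gcongr
    · exact le_self_add
    · exact le_add_self

/-! ### The trilinear form and its `L²` bounds -/

/-- The sesquilinear function `F G*`. -/
def mulConj {d : ℕ} (F G : Eucl d → ℂ) : Eucl d → ℂ := fun x => F x * conj (G x)

/-- The trilinear function `(W ∗ (F G*)) H`. -/
noncomputable def hartreeTri {d : ℕ} (W F G H : Eucl d → ℂ) : Eucl d → ℂ := fun x =>
  (W ⋆[ContinuousLinearMap.mul ℂ ℂ, volume] mulConj F G) x * H x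

/-- The norm of `L² ∩ L^∞`. -/
noncomputable def normTwoTop {d : ℕ} (F : Eucl d → ℂ) : ℝ≥0∞ :=
  eLpNorm F 2 volume + eLpNorm F ∞ volume

/-- `F` and `G` are square integrable, and one of them is bounded. -/
structure MemPair {d : ℕ} (F G : Eucl d → ℂ) : Prop where
  left : MemLp F 2 volume
  right : MemLp G 2 volume
  top : MemLp F ∞ volume ∨ MemLp G ∞ volume

section

variable {d : ℕ} {W F G H : Eucl d → ℂ} {K : ℝ≥0∞}

theorem MemLp.conj' {q : ℝ≥0∞} (hG : MemLp G q volume) :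
    MemLp (fun x => conj (G x)) q volume := by
  refine hG.of_le (Complex.continuous_conj.comp_aestronglyMeasurable hG.1) ?_
  filter_upwards with x
  simp

theorem eLpNorm_conj' (G : Eucl d → ℂ) (q : ℝ≥0∞) :
    eLpNorm (fun x => conj (G x)) q volume = eLpNorm G q volume :=
  eLpNorm_congr_norm_ae (by filter_upwards with x; simp)

theorem MemPair.memLp_one (h : MemPair F G) : MemLp (mulConj F G) 1 volume :=
  (MemLp.conj' h.right).mul h.left

theorem MemPair.memLp_two (h : MemPair F G) : MemLp (mulConj F G) 2 volume := by
  rcases h.top with h1 | h1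
  · exact (MemLp.conj' h.right).mul h1
  · exact (MemLp.conj' h1).mul h.left

/-- Hölder with exponents `(2, 2)` and `(2, ∞)`. If `G` is unbounded, the inequality still holds in
`ℝ≥0∞`. -/
theorem MemPair.eLpNorm_le_left (h : MemPair F G) :
    eLpNorm (mulConj F G) 1 volume + eLpNorm (mulConj F G) 2 volume ≤
      eLpNorm F 2 volume * normTwoTop G := by
  rw [normTwoTop, mul_add]
  refine add_le_add ?_ ?_
  · rw [← eLpNorm_conj' G]
    exact eLpNorm_mul_le_of_holderTriple (r := 1) (g := fun x => conj (G x)) h.left.1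
      (MemLp.conj' h.right).1
  · rw [← eLpNorm_conj' G]
    exact eLpNorm_mul_le_of_holderTriple (r := 2) (g := fun x => conj (G x)) h.left.1
      (MemLp.conj' h.right).1

theorem MemPair.eLpNorm_le_right (h : MemPair F G) :
    eLpNorm (mulConj F G) 1 volume + eLpNorm (mulConj F G) 2 volume ≤
      normTwoTop F * eLpNorm G 2 volume := by
  rw [normTwoTop, add_mul]
  refine add_le_add ?_ ?_
  · rw [← eLpNorm_conj' G]
    exact eLpNorm_mul_le_of_holderTriple (r := 1) (g := fun x => conj (G x)) h.left.1
      (MemLp.conj' h.right).1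
  · rw [← eLpNorm_conj' G]
    exact eLpNorm_mul_le_of_holderTriple (r := 2) (g := fun x => conj (G x)) h.left.1
      (MemLp.conj' h.right).1

theorem ConvBound.exists_mulConj (hW : ConvBound W K) (h : MemPair F G) :
    ConvolutionExists W (mulConj F G) (ContinuousLinearMap.mul ℂ ℂ) volume :=
  hW.exists_conv _ h.memLp_one h.memLp_two

theorem ConvBound.aestronglyMeasurable_hartreeTri (hW : ConvBound W K) (h : MemPair F G)
    (hH : MemLp H 2 volume) : AEStronglyMeasurable (hartreeTri W F G H) volume := by
  refine AEStronglyMeasurable.mul ?_ hH.1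
  exact (hW.aesm.convolution_integrand (ContinuousLinearMap.mul ℂ ℂ)
    h.memLp_one.1).integral_prod_right'

theorem ConvBound.eLpNorm_hartreeTri_le (hW : ConvBound W K) (h : MemPair F G) :
    eLpNorm (hartreeTri W F G H) 2 volume ≤
      K * (eLpNorm (mulConj F G) 1 volume + eLpNorm (mulConj F G) 2 volume) *
        eLpNorm H 2 volume := by
  have hfin : K * (eLpNorm (mulConj F G) 1 volume + eLpNorm (mulConj F G) 2 volume) ≠ ∞ :=
    ENNReal.mul_ne_top hW.ne_top
      (ENNReal.add_lt_top.2 ⟨h.memLp_one.2, h.memLp_two.2⟩).ne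
  have hb := hW.enorm_le _ h.memLp_one h.memLp_two
  lift K * (eLpNorm (mulConj F G) 1 volume + eLpNorm (mulConj F G) 2 volume) to NNReal
    using hfin with c hc
  refine (eLpNorm_le_nnreal_smul_eLpNorm_of_ae_le_mul (c := c) ?_ 2).trans (le_of_eq rfl)
  filter_upwards with x
  rw [← ENNReal.coe_le_coe, ENNReal.coe_mul]
  simp only [← enorm_eq_nnnorm]
  rw [hartreeTri, enorm_mul]
  gcongr
  exact hb x

theorem ConvBound.memLp_hartreeTri (hW : ConvBound W K) (h : MemPair F G)
    (hH : MemLp H 2 volume) : MemLp (hartreeTri W F G H) 2 volume :=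
  ⟨hW.aestronglyMeasurable_hartreeTri h hH, (hW.eLpNorm_hartreeTri_le h).trans_lt
    (ENNReal.mul_lt_top (ENNReal.mul_lt_top hW.ne_top.lt_top
      (ENNReal.add_lt_top.2 ⟨h.memLp_one.2, h.memLp_two.2⟩)) hH.2)⟩

theorem ConvBound.eLpNorm_hartreeTri_le_left (hW : ConvBound W K) (h : MemPair F G) :
    eLpNorm (hartreeTri W F G H) 2 volume ≤
      K * (eLpNorm F 2 volume * normTwoTop G) * eLpNorm H 2 volume := by
  refine (hW.eLpNorm_hartreeTri_le h).trans ?_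
  gcongr
  exact h.eLpNorm_le_left

theorem ConvBound.eLpNorm_hartreeTri_le_right (hW : ConvBound W K) (h : MemPair F G) :
    eLpNorm (hartreeTri W F G H) 2 volume ≤
      K * (normTwoTop F * eLpNorm G 2 volume) * eLpNorm H 2 volume := by
  refine (hW.eLpNorm_hartreeTri_le h).trans ?_
  gcongr
  exact h.eLpNorm_le_right

theorem ConvBound.convolution_mulConj_add_left (hW : ConvBound W K) {F₁ F₂ : Eucl d → ℂ}
    (h₁ : MemPair F₁ G) (h₂ : MemPair F₂ G) :
    W ⋆[ContinuousLinearMap.mul ℂ ℂ, volume] mulConj (F₁ + F₂) G =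
      W ⋆[ContinuousLinearMap.mul ℂ ℂ, volume] mulConj F₁ G +
        W ⋆[ContinuousLinearMap.mul ℂ ℂ, volume] mulConj F₂ G := by
  rw [← (hW.exists_mulConj h₁).distrib_add (hW.exists_mulConj h₂)]
  congr 1
  ext x
  simp [mulConj, add_mul]

theorem ConvBound.convolution_mulConj_add_right (hW : ConvBound W K) {G₁ G₂ : Eucl d → ℂ}
    (h₁ : MemPair F G₁) (h₂ : MemPair F G₂) :
    W ⋆[ContinuousLinearMap.mul ℂ ℂ, volume] mulConj F (G₁ + G₂) =
      W ⋆[ContinuousLinearMap.mul ℂ ℂ, volume] mulConj F G₁ +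
        W ⋆[ContinuousLinearMap.mul ℂ ℂ, volume] mulConj F G₂ := by
  rw [← (hW.exists_mulConj h₁).distrib_add (hW.exists_mulConj h₂)]
  congr 1
  ext x
  simp [mulConj, mul_add]

/-! ### Leibniz rule for differences of the trilinear form -/

theorem hartreeTri_comp_add (W F G H : Eucl d → ℂ) (h x : Eucl d) :
    hartreeTri W F G H (x + h) =
      hartreeTri W (fun y => F (y + h)) (fun y => G (y + h)) (fun y => H (y + h)) x := by
  simp only [hartreeTri, convolution_def, mulConj, sub_add_eq_add_sub]

/-- `F` is square integrable and bounded. -/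
structure MemTwoTop (F : Eucl d → ℂ) : Prop where
  two : MemLp F 2 volume
  top : MemLp F ∞ volume

theorem MemTwoTop.pair (hF : MemTwoTop F) (hG : MemTwoTop G) : MemPair F G :=
  ⟨hF.two, hG.two, Or.inl hF.top⟩

theorem MemTwoTop.pair_left (hF : MemTwoTop F) (hG : MemLp G 2 volume) : MemPair F G :=
  ⟨hF.two, hG, Or.inl hF.top⟩

theorem MemTwoTop.pair_right (hF : MemLp F 2 volume) (hG : MemTwoTop G) : MemPair F G :=
  ⟨hF, hG.two, Or.inr hG.top⟩

theorem MemTwoTop.add (hF : MemTwoTop F) (hG : MemTwoTop G) : MemTwoTop (F + G) :=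
  ⟨hF.two.add hG.two, hF.top.add hG.top⟩

theorem MemTwoTop.normTwoTop_ne_top (hF : MemTwoTop F) : normTwoTop F ≠ ∞ :=
  (ENNReal.add_lt_top.2 ⟨hF.two.2, hF.top.2⟩).ne

theorem MemLp.comp_add_const {q : ℝ≥0∞} (hF : MemLp F q volume) (h : Eucl d) :
    MemLp (fun y => F (y + h)) q volume :=
  hF.comp_measurePreserving (measurePreserving_add_right volume h)

theorem MemLp.eLpNorm_comp_add_const {q : ℝ≥0∞} (hF : MemLp F q volume) (h : Eucl d) :
    eLpNorm (fun y => F (y + h)) q volume = eLpNorm F q volume :=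
  eLpNorm_comp_measurePreserving hF.1 (measurePreserving_add_right volume h)

theorem MemLp.fwdDiff {q : ℝ≥0∞} (hF : MemLp F q volume) (h : Eucl d) :
    MemLp (fwdDiff h F) q volume :=
  (MemLp.comp_add_const hF h).sub hF

theorem MemLp.eLpNorm_fwdDiff_le {q : ℝ≥0∞} (hq : 1 ≤ q) (hF : MemLp F q volume) (h : Eucl d) :
    eLpNorm (_root_.fwdDiff h F) q volume ≤ 2 * eLpNorm F q volume := by
  refine (eLpNorm_sub_le (MemLp.comp_add_const hF h).1 hF.1 hq).trans ?_
  rw [MemLp.eLpNorm_comp_add_const hF, two_mul]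

theorem MemLp.fwdDiff_iter {q : ℝ≥0∞} (hF : MemLp F q volume) (h : Eucl d) (n : ℕ) :
    MemLp ((_root_.fwdDiff h)^[n] F) q volume := by
  induction n with
  | zero => exact hF
  | succ n ih => rw [Function.iterate_succ_apply']; exact MemLp.fwdDiff ih h

theorem MemLp.eLpNorm_fwdDiff_iter_le {q : ℝ≥0∞} (hq : 1 ≤ q) (hF : MemLp F q volume)
    (h : Eucl d) (n : ℕ) :
    eLpNorm ((_root_.fwdDiff h)^[n] F) q volume ≤ 2 ^ n * eLpNorm F q volume := by
  induction n with
  | zero => simp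
  | succ n ih =>
    rw [Function.iterate_succ_apply', pow_succ', mul_assoc]
    exact (MemLp.eLpNorm_fwdDiff_le hq (MemLp.fwdDiff_iter hF h n) h).trans (by gcongr)

/-- Translate all three arguments and telescope, changing one at a time. The assumptions on `F` and
`G` ensure that the convolutions being split exist. -/
theorem ConvBound.fwdDiff_hartreeTri (hW : ConvBound W K) (hF : MemTwoTop F) (hG : MemTwoTop G)
    (h : Eucl d) :
    fwdDiff h (hartreeTri W F G H) =
      hartreeTri W (fwdDiff h F) (fun y => G (y + h)) (fun y => H (y + h)) +
      hartreeTri W F (fwdDiff h G) (fun y => H (y + h)) +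
      hartreeTri W F G (fwdDiff h H) := by
  have hF' : MemTwoTop (fwdDiff h F) := ⟨MemLp.fwdDiff hF.two h, MemLp.fwdDiff hF.top h⟩
  have hG' : MemTwoTop (fwdDiff h G) := ⟨MemLp.fwdDiff hG.two h, MemLp.fwdDiff hG.top h⟩
  have hGs : MemTwoTop fun y => G (y + h) :=
    ⟨MemLp.comp_add_const hG.two h, MemLp.comp_add_const hG.top h⟩
  have e1 : (fun y => F (y + h)) = fwdDiff h F + F := by ext; simp [fwdDiff]
  have e2 : (fun y => G (y + h)) = fwdDiff h G + G := by ext; simp [fwdDiff]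
  ext x
  have h1 := hartreeTri_comp_add W F G H h x
  have h2 := congrFun (hW.convolution_mulConj_add_left (hF'.pair hGs) (hF.pair hGs)) x
  have h3 := congrFun (hW.convolution_mulConj_add_right (hF.pair hG') (hF.pair hG)) x
  rw [← e1] at h2
  rw [← e2] at h3
  rw [fwdDiff, h1]
  simp only [hartreeTri, Pi.add_apply] at h2 h3 ⊢
  rw [h2, h3, fwdDiff]
  ring

/-- The translate by `i h` of the `a`-th difference of `u` with step `h`. -/
def shiftDiff (h : Eucl d) (u : Eucl d → ℂ) (a i : ℕ) : Eucl d → ℂ :=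
  fun y => (fwdDiff h)^[a] u (y + i • h)

theorem shiftDiff_comp_add (h : Eucl d) (u : Eucl d → ℂ) (a i : ℕ) :
    (fun y => shiftDiff h u a i (y + h)) = shiftDiff h u a (i + 1) := by
  ext y
  simp only [shiftDiff, add_nsmul, one_nsmul]
  rw [show y + h + i • h = y + (i • h + h) by abel]

theorem fwdDiff_shiftDiff (h : Eucl d) (u : Eucl d → ℂ) (a i : ℕ) :
    fwdDiff h (shiftDiff h u a i) = shiftDiff h u (a + 1) i := by
  ext y
  simp only [shiftDiff, fwdDiff, Function.iterate_succ_apply']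
  rw [add_right_comm]

theorem memTwoTop_shiftDiff {u : Eucl d → ℂ} (hu : MemTwoTop u) (h : Eucl d) (a i : ℕ) :
    MemTwoTop (shiftDiff h u a i) :=
  ⟨MemLp.comp_add_const (MemLp.fwdDiff_iter hu.two h a) _,
    MemLp.comp_add_const (MemLp.fwdDiff_iter hu.top h a) _⟩

theorem normTwoTop_shiftDiff_le {u : Eucl d → ℂ} (hu : MemTwoTop u) (h : Eucl d) {a N : ℕ}
    (haN : a ≤ N) (i : ℕ) : normTwoTop (shiftDiff h u a i) ≤ 2 ^ N * normTwoTop u := by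
  have h1 : (2 : ℝ≥0∞) ^ a ≤ 2 ^ N := pow_le_pow_right₀ one_le_two haN
  rw [normTwoTop, normTwoTop, mul_add]
  refine add_le_add ?_ ?_
  · unfold shiftDiff
    rw [MemLp.eLpNorm_comp_add_const (MemLp.fwdDiff_iter hu.two h a)]
    exact (MemLp.eLpNorm_fwdDiff_iter_le one_le_two hu.two h a).trans (by gcongr)
  · unfold shiftDiff
    rw [MemLp.eLpNorm_comp_add_const (MemLp.fwdDiff_iter hu.top h a)]
    exact (MemLp.eLpNorm_fwdDiff_iter_le le_top hu.top h a).trans (by gcongr)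

theorem eLpNorm_shiftDiff_le {u : Eucl d → ℂ} (hu : MemTwoTop u) (h : Eucl d) {a m N : ℕ}
    (hma : m ≤ a) (haN : a ≤ N) (i : ℕ) :
    eLpNorm (shiftDiff h u a i) 2 volume ≤ 2 ^ N * eLpNorm ((fwdDiff h)^[m] u) 2 volume := by
  have h1 : (2 : ℝ≥0∞) ^ (a - m) ≤ 2 ^ N := pow_le_pow_right₀ one_le_two (by omega)
  unfold shiftDiff
  rw [MemLp.eLpNorm_comp_add_const (MemLp.fwdDiff_iter hu.two h a)]
  have h2 : a = (a - m) + m := by omega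
  rw [h2, Function.iterate_add_apply]
  exact (MemLp.eLpNorm_fwdDiff_iter_le one_le_two (MemLp.fwdDiff_iter hu.two h m) h _).trans
    (by gcongr)

/-- Each difference turns one term into three and raises one of `a`, `b`, `c` by one, so `a + b + c
+ n` stays equal to `N`. The shifts `i`, `j`, `k` are left arbitrary because the Leibniz rule
changes them. -/
theorem ConvBound.eLpNorm_fwdDiff_iter_hartreeTri_le_of_forall (hW : ConvBound W K)
    {u : Eucl d → ℂ} (hu : MemTwoTop u) (h : Eucl d) (N : ℕ) (M : ℝ≥0∞)
    (hM : ∀ a b c i j k, a + b + c = N → eLpNorm (hartreeTri W (shiftDiff h u a i)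
      (shiftDiff h u b j) (shiftDiff h u c k)) 2 volume ≤ M) (n : ℕ) :
    ∀ a b c i j k, a + b + c + n = N → eLpNorm ((fwdDiff h)^[n] (hartreeTri W
      (shiftDiff h u a i) (shiftDiff h u b j) (shiftDiff h u c k))) 2 volume ≤ 3 ^ n * M := by
  have hm : ∀ a b c i j k n, AEStronglyMeasurable ((fwdDiff h)^[n] (hartreeTri W
      (shiftDiff h u a i) (shiftDiff h u b j) (shiftDiff h u c k))) volume := fun a b c i j k n =>
    (MemLp.fwdDiff_iter (hW.memLp_hartreeTri
      ((memTwoTop_shiftDiff hu h a i).pair (memTwoTop_shiftDiff hu h b j))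
      (memTwoTop_shiftDiff hu h c k).two) h n).1
  induction n with
  | zero =>
    intro a b c i j k habc
    simpa using hM a b c i j k habc
  | succ n ih =>
    intro a b c i j k habc
    rw [Function.iterate_succ_apply, hW.fwdDiff_hartreeTri (memTwoTop_shiftDiff hu h a i)
      (memTwoTop_shiftDiff hu h b j), fwdDiff_iter_add, fwdDiff_iter_add]
    simp only [shiftDiff_comp_add, fwdDiff_shiftDiff]
    refine (eLpNorm_add_le ((hm _ _ _ _ _ _ _).add (hm _ _ _ _ _ _ _)) (hm _ _ _ _ _ _ _)
      one_le_two).trans ?_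
    refine (add_le_add_left (eLpNorm_add_le (hm _ _ _ _ _ _ _) (hm _ _ _ _ _ _ _)
      one_le_two) _).trans ?_
    refine (add_le_add (add_le_add (ih _ _ _ _ _ _ (by omega)) (ih _ _ _ _ _ _ (by omega)))
      (ih _ _ _ _ _ _ (by omega))).trans (le_of_eq ?_)
    ring

theorem ConvBound.eLpNorm_fwdDiff_iter_hartreeTri_le (hW : ConvBound W K) {u : Eucl d → ℂ}
    (hu : MemTwoTop u) (h : Eucl d) (m : ℕ) :
    eLpNorm ((fwdDiff h)^[3 * m] (hartreeTri W u u u)) 2 volume ≤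
      3 ^ (3 * m) * (K * (2 ^ (3 * m)) ^ 3 * normTwoTop u ^ 2) *
        eLpNorm ((fwdDiff h)^[m] u) 2 volume := by
  have h0 : shiftDiff h u 0 0 = u := by ext; simp [shiftDiff]
  set δ := eLpNorm ((fwdDiff h)^[m] u) 2 volume with hδ
  set P : ℝ≥0∞ := 2 ^ (3 * m) with hP
  -- Each argument costs at most one factor `P`: at most `3m` differences are applied to it, and
  -- each at most doubles a norm.
  have key := hW.eLpNorm_fwdDiff_iter_hartreeTri_le_of_forall hu h (3 * m)
    (K * P ^ 3 * normTwoTop u ^ 2 * δ) ?_ (3 * m) 0 0 0 0 0 0 (by simp)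
  · rw [h0, ← mul_assoc] at key
    exact key
  intro a b c i j k habc
  have hmem := memTwoTop_shiftDiff hu h
  have hN : ∀ {e : ℕ}, e ≤ 3 * m → ∀ i, normTwoTop (shiftDiff h u e i) ≤ P * normTwoTop u :=
    fun he i => normTwoTop_shiftDiff_le hu h he i
  have h2 : ∀ {e : ℕ}, e ≤ 3 * m → ∀ i, eLpNorm (shiftDiff h u e i) 2 volume ≤
      P * normTwoTop u := fun he i => le_self_add.trans (hN he i)
  have hD : ∀ {e : ℕ}, m ≤ e → e ≤ 3 * m → ∀ i, eLpNorm (shiftDiff h u e i) 2 volume ≤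
      P * δ := fun hme he i => eLpNorm_shiftDiff_le hu h hme he i
  have ha : a ≤ 3 * m := by omega
  have hb : b ≤ 3 * m := by omega
  have hc : c ≤ 3 * m := by omega
  -- Pigeonhole on `a + b + c = 3m`; the argument with at least `m` differences is measured in `L²`
  -- and yields `δ`.
  rcases (by omega : m ≤ a ∨ m ≤ b ∨ m ≤ c) with hma | hmb | hmc
  · refine (hW.eLpNorm_hartreeTri_le_left ((hmem a i).pair (hmem b j))).trans ?_
    refine (mul_le_mul' (mul_le_mul' le_rfl (mul_le_mul' (hD hma ha i) (hN hb j)))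
      (h2 hc k)).trans (le_of_eq ?_)
    ring
  · refine (hW.eLpNorm_hartreeTri_le_right ((hmem a i).pair (hmem b j))).trans ?_
    refine (mul_le_mul' (mul_le_mul' le_rfl (mul_le_mul' (hN ha i) (hD hmb hb j)))
      (h2 hc k)).trans (le_of_eq ?_)
    ring
  · refine (hW.eLpNorm_hartreeTri_le_left ((hmem a i).pair (hmem b j))).trans ?_
    refine (mul_le_mul' (mul_le_mul' le_rfl (mul_le_mul' (h2 ha i) (hN hb j)))
      (hD hmc hc k)).trans (le_of_eq ?_)
    ring

end

theorem fwdDiff_iter_congr_ae {d : ℕ} {f g : Eucl d → ℂ} (hfg : f =ᵐ[volume] g) (h : Eucl d)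
    (n : ℕ) : (fwdDiff h)^[n] f =ᵐ[volume] (fwdDiff h)^[n] g := by
  induction n with
  | zero => exact hfg
  | succ n ih =>
    filter_upwards [ih, (measurePreserving_add_right volume h).quasiMeasurePreserving.ae_eq_comp ih]
      with x h1 h2
    simp only [Function.comp_apply] at h2
    simp only [Function.iterate_succ_apply', fwdDiff, h1, h2]

/-- The Hartree nonlinearity maps `H^s` to `H^s` for `s > 0` on bounded functions. -/
theorem ConvBound.memSobolev_hartreeTri {d : ℕ} {s : ℝ} (hs : 0 < s) {W : Eucl d → ℂ} {K : ℝ≥0∞}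
    (hW : ConvBound W K) (u : HSob d s) (hu : MemTwoTop (HSob.toL2 u : Eucl d → ℂ)) (f : L2 d)
    (hf : f =ᵐ[volume] hartreeTri W (HSob.toL2 u) (HSob.toL2 u) (HSob.toL2 u)) :
    MemSobolev s 2 (f : 𝓢'(Eucl d, ℂ)) := by
  obtain ⟨m, hm⟩ := exists_nat_gt s
  have hm0 : m ≠ 0 := by
    rintro rfl
    exact (hs.trans hm).ne' (by simp)
  -- Order `3m` for `f` matches order `m > s` for `u`, whose difference integral is finite.
  refine L2.memSobolev_of_lintegral_fwdDiff_iter_lt_top hs f (n := 3 * m) (by omega) fun j => ?_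
  set C : ℝ≥0∞ := 3 ^ (3 * m) * (K * (2 ^ (3 * m)) ^ 3 * normTwoTop (HSob.toL2 u) ^ 2) with hC
  have hCt : C ≠ ∞ := by
    have h1 := hW.ne_top
    have h2 := hu.normTwoTop_ne_top
    finiteness
  calc _ ≤ ∫⁻ t in Set.Ioi (0 : ℝ), C ^ 2 * (eLpNorm ((fwdDiff (EuclideanSpace.single j t :
        Eucl d))^[m] (HSob.toL2 u)) 2 volume ^ 2 * ENNReal.ofReal (t ^ (-1 - 2 * s))) := by
        refine lintegral_mono fun t => ?_
        rw [← mul_assoc, ← mul_pow]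
        gcongr
        rw [eLpNorm_congr_ae (fwdDiff_iter_congr_ae hf _ _)]
        exact hW.eLpNorm_fwdDiff_iter_hartreeTri_le hu _ m
    _ = C ^ 2 * ∫⁻ t in Set.Ioi (0 : ℝ), (eLpNorm ((fwdDiff (EuclideanSpace.single j t :
        Eucl d))^[m] (HSob.toL2 u)) 2 volume ^ 2 * ENNReal.ofReal (t ^ (-1 - 2 * s))) :=
        lintegral_const_mul' _ _ (by finiteness)
    _ < ∞ := ENNReal.mul_lt_top (by finiteness)
        (HSob.lintegral_eLpNorm_fwdDiff_iter_lt_top hs u hm j)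

/-! ### The derivative and the remainder -/

section

variable {d : ℕ} {W u v w : Eucl d → ℂ} {K : ℝ≥0∞}

theorem ofReal_comp_absSq (u : Eucl d → ℂ) : (fun y => (absSq u y : ℂ)) = mulConj u u := by
  ext y
  simp [absSq, mulConj, Complex.mul_conj']

theorem ofReal_comp_reConjMul (u v : Eucl d → ℂ) :
    (fun y => (reConjMul u v y : ℂ)) = (1 / 2 : ℂ) • (mulConj v u + mulConj u v) := by
  ext y
  simp only [reConjMul, mulConj, Pi.smul_apply, Pi.add_apply, smul_eq_mul]
  rw [Complex.re_eq_add_conj]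
  simp only [map_mul, Complex.conj_conj]
  ring

theorem hartree_eq_hartreeTri (W u : Eucl d → ℂ) : hartree W u = hartreeTri W u u u := by
  ext x
  simp only [hartree, conv, ofReal_comp_absSq, hartreeTri]

/-- Writing `2 Re(u* v) = v u* + u v*` absorbs the factor `2`. The last term is conjugate-linear in
`v`, which is why only real linearity is available. -/
theorem ConvBound.hartreeDeriv_eq (hW : ConvBound W K) (hu : MemTwoTop u)
    (hv : MemLp v 2 volume) :
    hartreeDeriv W u v = hartreeTri W u u v + hartreeTri W v u u + hartreeTri W u v u := by
  ext x
  simp only [hartreeDeriv, conv, ofReal_comp_absSq, ofReal_comp_reConjMul,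
    convolution_smul]
  rw [(hW.exists_mulConj (MemTwoTop.pair_right hv hu)).distrib_add
    (hW.exists_mulConj (hu.pair_left hv))]
  simp only [hartreeTri, Pi.add_apply, Pi.smul_apply, smul_eq_mul]
  ring

theorem ConvBound.convExists_absSq (hW : ConvBound W K) (hu : MemTwoTop u) :
    ConvExists W (absSq u) := by
  rw [ConvExists, ofReal_comp_absSq]
  exact hW.exists_mulConj (hu.pair hu)

theorem ConvBound.convExists_reConjMul (hW : ConvBound W K) (hu : MemTwoTop u)
    (hv : MemLp v 2 volume) : ConvExists W (reConjMul u v) := by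
  rw [ConvExists, ofReal_comp_reConjMul]
  have h1 := MemTwoTop.pair_right hv hu
  have h2 := hu.pair_left hv
  exact hW.exists_conv _ ((h1.memLp_one.add h2.memLp_one).const_smul _)
    ((h1.memLp_two.add h2.memLp_two).const_smul _)

/-- The convolution is unchanged at every point by null-set modifications, so the form descends to
`L²` classes. -/
theorem hartreeTri_congr {F F' G G' H H' : Eucl d → ℂ} (hF : F =ᵐ[volume] F')
    (hG : G =ᵐ[volume] G') (hH : H =ᵐ[volume] H') :
    hartreeTri W F G H =ᵐ[volume] hartreeTri W F' G' H' := by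
  have h1 : mulConj F G =ᵐ[volume] mulConj F' G' := by
    filter_upwards [hF, hG] with x h1 h2
    simp only [mulConj, h1, h2]
  have h2 := convolution_congr (L := ContinuousLinearMap.mul ℂ ℂ)
    (Filter.EventuallyEq.refl (ae (volume : Measure (Eucl d))) W) h1
  filter_upwards [hH] with x hx
  simp only [hartreeTri, h2, hx]

theorem ConvBound.memLp_hartreeDeriv (hW : ConvBound W K) (hu : MemTwoTop u)
    (hv : MemLp v 2 volume) : MemLp (hartreeDeriv W u v) 2 volume := by
  rw [hW.hartreeDeriv_eq hu hv]
  exact ((hW.memLp_hartreeTri (hu.pair hu) hv).add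
    (hW.memLp_hartreeTri (MemTwoTop.pair_right hv hu) hu.two)).add
    (hW.memLp_hartreeTri (hu.pair_left hv) hu.two)

theorem ConvBound.eLpNorm_hartreeDeriv_le (hW : ConvBound W K) (hu : MemTwoTop u)
    (hv : MemLp v 2 volume) :
    eLpNorm (hartreeDeriv W u v) 2 volume ≤
      3 * K * normTwoTop u ^ 2 * eLpNorm v 2 volume := by
  have h1 := hW.memLp_hartreeTri (hu.pair hu) hv
  have h2 := hW.memLp_hartreeTri (MemTwoTop.pair_right hv hu) hu.two
  have h3 := hW.memLp_hartreeTri (hu.pair_left hv) hu.two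
  have hN : eLpNorm u 2 volume ≤ normTwoTop u := le_self_add
  rw [hW.hartreeDeriv_eq hu hv]
  refine (eLpNorm_add_le (h1.1.add h2.1) h3.1 one_le_two).trans ?_
  refine (add_le_add_left (eLpNorm_add_le h1.1 h2.1 one_le_two) _).trans ?_
  calc _ ≤ K * (normTwoTop u * normTwoTop u) * eLpNorm v 2 volume +
        K * (eLpNorm v 2 volume * normTwoTop u) * normTwoTop u +
        K * (normTwoTop u * eLpNorm v 2 volume) * normTwoTop u := by
        refine add_le_add (add_le_add ?_ ?_) ?_
        · exact (hW.eLpNorm_hartreeTri_le_left (hu.pair hu)).trans (by gcongr)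
        · exact (hW.eLpNorm_hartreeTri_le_left (MemTwoTop.pair_right hv hu)).trans (by gcongr)
        · exact (hW.eLpNorm_hartreeTri_le_right (hu.pair_left hv)).trans (by gcongr)
    _ = _ := by ring

theorem ConvBound.hartreeDeriv_add (hW : ConvBound W K) (hu : MemTwoTop u)
    (hv : MemLp v 2 volume) (hw : MemLp w 2 volume) :
    hartreeDeriv W u (v + w) = hartreeDeriv W u v + hartreeDeriv W u w := by
  rw [hW.hartreeDeriv_eq hu hv, hW.hartreeDeriv_eq hu hw, hW.hartreeDeriv_eq hu (hv.add hw)]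
  ext x
  have h1 := congrFun (hW.convolution_mulConj_add_left (MemTwoTop.pair_right hv hu)
    (MemTwoTop.pair_right hw hu)) x
  have h2 := congrFun (hW.convolution_mulConj_add_right (hu.pair_left hv) (hu.pair_left hw)) x
  simp only [hartreeTri, Pi.add_apply] at h1 h2 ⊢
  rw [h1, h2]
  ring

theorem ConvBound.hartreeDeriv_smul (hW : ConvBound W K) (hu : MemTwoTop u)
    (hv : MemLp v 2 volume) (c : ℝ) :
    hartreeDeriv W u (c • v) = c • hartreeDeriv W u v := by
  rw [hW.hartreeDeriv_eq hu hv, hW.hartreeDeriv_eq hu (hv.const_smul c)]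
  have h1 : mulConj (c • v) u = (c : ℂ) • mulConj v u := by
    ext x; simp [mulConj, mul_assoc]
  have h2 : mulConj u (c • v) = (c : ℂ) • mulConj u v := by
    ext x; simp [mulConj, mul_left_comm]
  ext x
  simp only [hartreeTri, Pi.add_apply, Pi.smul_apply, h1, h2, convolution_smul,
    Complex.real_smul, smul_eq_mul]
  ring

theorem ConvBound.exists_hartreeDeriv_clm (hW : ConvBound W K) (hu : MemTwoTop u) :
    ∃ T : L2 d →L[ℝ] L2 d, (∀ v : L2 d, T v =ᵐ[volume] hartreeDeriv W u v) ∧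
      ‖T‖ ≤ (3 * K * normTwoTop u ^ 2).toReal := by
  have hcongr : ∀ {v w : Eucl d → ℂ}, MemLp v 2 volume → v =ᵐ[volume] w →
      hartreeDeriv W u v =ᵐ[volume] hartreeDeriv W u w := by
    intro v w hv hvw
    rw [hW.hartreeDeriv_eq hu hv, hW.hartreeDeriv_eq hu ((memLp_congr_ae hvw).1 hv)]
    exact ((hartreeTri_congr .rfl .rfl hvw).add (hartreeTri_congr hvw .rfl .rfl)).add
      (hartreeTri_congr .rfl hvw .rfl)
  have hm : ∀ v : L2 d, MemLp (hartreeDeriv W u v) 2 volume := fun v =>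
    hW.memLp_hartreeDeriv hu (Lp.memLp v)
  have hfin : 3 * K * normTwoTop u ^ 2 ≠ ∞ := by
    have h1 := hW.ne_top
    have h2 := hu.normTwoTop_ne_top
    finiteness
  let T₀ : L2 d →ₗ[ℝ] L2 d :=
    { toFun := fun v => (hm v).toLp _
      map_add' := fun v w => by
        apply Lp.ext
        refine (hm (v + w)).coeFn_toLp.trans ?_
        refine (hcongr (Lp.memLp _) (Lp.coeFn_add v w)).trans ?_
        rw [hW.hartreeDeriv_add hu (Lp.memLp v) (Lp.memLp w)]
        exact ((hm v).coeFn_toLp.add (hm w).coeFn_toLp).symm.trans (Lp.coeFn_add _ _).symm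
      map_smul' := fun c v => by
        apply Lp.ext
        refine (hm (c • v)).coeFn_toLp.trans ?_
        refine (hcongr (Lp.memLp _) (Lp.coeFn_smul c v)).trans ?_
        rw [hW.hartreeDeriv_smul hu (Lp.memLp v)]
        exact ((hm v).coeFn_toLp.const_smul c).symm.trans (Lp.coeFn_smul _ _).symm }
  refine ⟨T₀.mkContinuous (3 * K * normTwoTop u ^ 2).toReal fun v => ?_, fun v => ?_, ?_⟩
  · change ‖(hm v).toLp _‖ ≤ _
    rw [Lp.norm_toLp, Lp.norm_def, ← ENNReal.toReal_mul]
    exact ENNReal.toReal_mono (ENNReal.mul_ne_top hfin (Lp.memLp v).2.ne)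
      (hW.eLpNorm_hartreeDeriv_le hu (Lp.memLp v))
  · exact (hm v).coeFn_toLp
  · exact T₀.mkContinuous_norm_le ENNReal.toReal_nonneg _

/-- Of the eight terms of `T(u+w, u+w, u+w)`, those of degree `0` and `1` in `w` cancel. -/
theorem ConvBound.hartree_remainder_eq (hW : ConvBound W K) (hu : MemTwoTop u)
    (hw : MemTwoTop w) :
    hartree W (u + w) - hartree W u - hartreeDeriv W u w =
      hartreeTri W u w w + hartreeTri W w u w + hartreeTri W w w u + hartreeTri W w w w := by
  rw [hW.hartreeDeriv_eq hu hw.two]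
  simp only [hartree_eq_hartreeTri]
  ext x
  have h1 := congrFun (hW.convolution_mulConj_add_left (hu.pair (hu.add hw))
    (hw.pair (hu.add hw))) x
  have h2 := congrFun (hW.convolution_mulConj_add_right (hu.pair hu) (hu.pair hw)) x
  have h3 := congrFun (hW.convolution_mulConj_add_right (hw.pair hu) (hw.pair hw)) x
  simp only [hartreeTri, Pi.add_apply, Pi.sub_apply] at h1 h2 h3 ⊢
  rw [h1, h2, h3]
  ring

/-- In each remaining term one `w` is measured in `L²` and a second in `L² ∩ L^∞`; the latter
becomes small with the `H^s` norm. -/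
theorem ConvBound.eLpNorm_hartree_remainder_le (hW : ConvBound W K) (hu : MemTwoTop u)
    (hw : MemTwoTop w) :
    eLpNorm (hartree W (u + w) - hartree W u - hartreeDeriv W u w) 2 volume ≤
      K * normTwoTop w * (3 * normTwoTop u + normTwoTop w) * eLpNorm w 2 volume := by
  have h1 := (hW.memLp_hartreeTri (hu.pair hw) hw.two).1
  have h2 := (hW.memLp_hartreeTri (hw.pair hu) hw.two).1
  have h3 := (hW.memLp_hartreeTri (hw.pair hw) hu.two).1
  have h4 := (hW.memLp_hartreeTri (hw.pair hw) hw.two).1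
  have hNu : eLpNorm u 2 volume ≤ normTwoTop u := le_self_add
  have hNw : eLpNorm w 2 volume ≤ normTwoTop w := le_self_add
  rw [hW.hartree_remainder_eq hu hw]
  refine (eLpNorm_add_le ((h1.add h2).add h3) h4 one_le_two).trans ?_
  refine (add_le_add_left (eLpNorm_add_le (h1.add h2) h3 one_le_two) _).trans ?_
  refine (add_le_add_left (add_le_add_left (eLpNorm_add_le h1 h2 one_le_two) _) _).trans ?_
  calc _ ≤ K * (normTwoTop u * eLpNorm w 2 volume) * normTwoTop w +
        K * (eLpNorm w 2 volume * normTwoTop u) * normTwoTop w +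
        K * (eLpNorm w 2 volume * normTwoTop w) * normTwoTop u +
        K * (eLpNorm w 2 volume * normTwoTop w) * normTwoTop w := by
        refine add_le_add (add_le_add (add_le_add ?_ ?_) ?_) ?_
        · exact (hW.eLpNorm_hartreeTri_le_right (hu.pair hw)).trans (by gcongr)
        · exact (hW.eLpNorm_hartreeTri_le_left (hw.pair hu)).trans (by gcongr)
        · exact (hW.eLpNorm_hartreeTri_le_left (hw.pair hw)).trans (by gcongr)
        · exact (hW.eLpNorm_hartreeTri_le_left (hw.pair hw)).trans (by gcongr)
    _ = _ := by ring

theorem HSob.exists_normTwoTop_le {s : ℝ} (hs : (d : ℝ) / 2 < s) :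
    ∃ A : ℝ, 0 < A ∧ ∀ u : HSob d s,
      normTwoTop (HSob.toL2 u : Eucl d → ℂ) ≤ ENNReal.ofReal (A * ‖u‖) := by
  obtain ⟨C, hC, h⟩ := HSob.exists_eLpNorm_top_le hs
  refine ⟨1 + C, by positivity, fun u => ?_⟩
  rw [normTwoTop, add_mul, one_mul, ENNReal.ofReal_add (norm_nonneg _) (by positivity)]
  refine add_le_add ?_ (h u)
  rw [← Lp.enorm_def, ← ofReal_norm]
  exact ENNReal.ofReal_le_ofReal (HSob.norm_toL2_le (le_trans (by positivity) hs.le) u)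

theorem HSob.memTwoTop {s : ℝ} (hs : (d : ℝ) / 2 < s) (u : HSob d s) :
    MemTwoTop (HSob.toL2 u : Eucl d → ℂ) := by
  obtain ⟨C, -, h⟩ := HSob.exists_eLpNorm_top_le hs
  exact ⟨Lp.memLp _, (Lp.memLp _).1, (h u).trans_lt ENNReal.ofReal_lt_top⟩

theorem ConvBound.exists_hartree_HSob {s : ℝ} (hs : (d : ℝ) / 2 < s) (hW : ConvBound W K)
    (u : HSob d s) :
    ∃ b : HSob d s, (HSob.toL2 b : Eucl d → ℂ) =ᵐ[volume] hartree W (HSob.toL2 u) := by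
  have hu := u.memTwoTop hs
  have hm := hW.memLp_hartreeTri (hu.pair hu) hu.two
  rw [hartree_eq_hartreeTri]
  exact ⟨⟨hm.toLp _, hW.memSobolev_hartreeTri ((by positivity : (0 : ℝ) ≤ d / 2).trans_lt hs) u hu
    _ hm.coeFn_toLp⟩, hm.coeFn_toLp⟩

theorem ConvBound.norm_hartree_remainder_le {s : ℝ} (hs : (d : ℝ) / 2 < s) (hW : ConvBound W K)
    {u w b₁ b₂ : HSob d s} {t : L2 d}
    (h₁ : (HSob.toL2 b₁ : Eucl d → ℂ) =ᵐ[volume] hartree W (HSob.toL2 (u + w)))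
    (h₂ : (HSob.toL2 b₂ : Eucl d → ℂ) =ᵐ[volume] hartree W (HSob.toL2 u))
    (ht : t =ᵐ[volume] hartreeDeriv W (HSob.toL2 u) (HSob.toL2 w)) {r : ℝ} (hr : 0 ≤ r)
    (hKr : K * normTwoTop (HSob.toL2 w : Eucl d → ℂ) * (3 * normTwoTop (HSob.toL2 u : Eucl d → ℂ) +
      normTwoTop (HSob.toL2 w : Eucl d → ℂ)) ≤ ENNReal.ofReal r) :
    ‖HSob.toL2 b₁ - HSob.toL2 b₂ - t‖ ≤ r * ‖HSob.toL2 w‖ := by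
  have h3 : (HSob.toL2 b₁ : Eucl d → ℂ) =ᵐ[volume]
      hartree W ((HSob.toL2 u : Eucl d → ℂ) + HSob.toL2 w) := by
    refine h₁.trans ?_
    rw [map_add, hartree_eq_hartreeTri, hartree_eq_hartreeTri]
    have := Lp.coeFn_add (HSob.toL2 u) (HSob.toL2 w)
    exact hartreeTri_congr this this this
  have h4 : (HSob.toL2 b₁ - HSob.toL2 b₂ - t : L2 d) =ᵐ[volume]
      hartree W ((HSob.toL2 u : Eucl d → ℂ) + HSob.toL2 w) - hartree W (HSob.toL2 u) -
        hartreeDeriv W (HSob.toL2 u) (HSob.toL2 w) :=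
    (Lp.coeFn_sub _ _).trans (((Lp.coeFn_sub _ _).trans (h3.sub h₂)).sub ht)
  have h5 := (hW.eLpNorm_hartree_remainder_le (u.memTwoTop hs) (w.memTwoTop hs)).trans
    (mul_le_mul_left hKr _)
  rw [← eLpNorm_congr_ae h4, ← Lp.enorm_def, ← Lp.enorm_def, ← ofReal_norm, ← ofReal_norm,
    ← ENNReal.ofReal_mul hr] at h5
  exact (ENNReal.ofReal_le_ofReal_iff (by positivity)).1 h5

theorem ConvBound.derivCondition {s : ℝ} (hs : (d : ℝ) / 2 < s) (hW : ConvBound W K)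
    {B : HSob d s → HSob d s} {B' : HSob d s → (L2 d →L[ℝ] L2 d)}
    (hB : ∀ u, (HSob.toL2 (B u) : Eucl d → ℂ) =ᵐ[volume] hartree W (HSob.toL2 u))
    (hB' : ∀ (u : HSob d s) (v : L2 d), B' u v =ᵐ[volume] hartreeDeriv W (HSob.toL2 u) v)
    (hB'n : ∀ u, ‖B' u‖ ≤ (3 * K * normTwoTop (HSob.toL2 u : Eucl d → ℂ) ^ 2).toReal) :
    DerivCondition HSob.toL2 B B' := by
  intro R hR ε hε
  obtain ⟨A, hA, hAu⟩ := HSob.exists_normTwoTop_le hs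
  set k := K.toReal with hk
  have hk0 : 0 ≤ k := ENNReal.toReal_nonneg
  have hKk : K = ENNReal.ofReal k := (ENNReal.ofReal_toReal hW.ne_top).symm
  -- For `‖w‖ ≤ 1` the remainder factor is at most `(D - 1) ‖w‖`, so `δ = min 1 (ε / D)` works; the
  -- added `1` keeps `D` positive when `k = 0`.
  set D := k * A * (3 * (A * R) + A) + 1 with hD
  have hD0 : 0 < D := by positivity
  refine ⟨3 * k * (A * R) ^ 2 + 1, by positivity, min 1 (ε / D), by positivity,
    fun u w hu hw => ⟨?_, ?_⟩⟩
  · have hNu : normTwoTop (HSob.toL2 u : Eucl d → ℂ) ≤ ENNReal.ofReal (A * R) :=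
      (hAu u).trans (by gcongr)
    refine (hB'n u).trans (ENNReal.toReal_le_of_le_ofReal (by positivity) ?_)
    calc _ ≤ 3 * K * ENNReal.ofReal (A * R) ^ 2 := by gcongr
      _ = ENNReal.ofReal (3 * k * (A * R) ^ 2) := by
        rw [hKk, ← ENNReal.ofReal_pow (by positivity), ← ENNReal.ofReal_ofNat 3,
          ← ENNReal.ofReal_mul (by positivity), ← ENNReal.ofReal_mul (by positivity)]
      _ ≤ _ := ENNReal.ofReal_le_ofReal (by linarith)
  · have hw1 : ‖w‖ ≤ 1 := hw.le.trans (min_le_left _ _)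
    have hw2 : ‖w‖ ≤ ε / D := hw.le.trans (min_le_right _ _)
    have hNu : normTwoTop (HSob.toL2 u : Eucl d → ℂ) ≤ ENNReal.ofReal (A * R) :=
      (hAu u).trans (by gcongr)
    refine hW.norm_hartree_remainder_le hs (hB _) (hB _) (hB' _ _) hε.le ?_
    calc _ ≤ K * ENNReal.ofReal (A * ‖w‖) * (3 * ENNReal.ofReal (A * R) +
          ENNReal.ofReal (A * 1)) := by
          gcongr
          · exact hAu w
          · exact (hAu w).trans (by gcongr)
      _ = ENNReal.ofReal (k * (A * ‖w‖) * (3 * (A * R) + A * 1)) := by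
          rw [hKk, ← ENNReal.ofReal_ofNat 3, ← ENNReal.ofReal_mul (by positivity),
            ← ENNReal.ofReal_mul (by positivity), ← ENNReal.ofReal_add (by positivity)
            (by positivity), ← ENNReal.ofReal_mul (by positivity)]
      _ ≤ ENNReal.ofReal ε := by
          apply ENNReal.ofReal_le_ofReal
          calc _ = k * A * (3 * (A * R) + A) * ‖w‖ := by ring
            _ ≤ D * (ε / D) := by gcongr; linarith
            _ = ε := mul_div_cancel₀ _ hD0.ne'

end

theorem mainTheorem8 (d : ℕ) (s : ℝ) (hs : (d : ℝ) / 2 < s)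
    (p : ℝ≥0∞) (hp : 2 ≤ p) (hpd : (d : ℝ≥0∞) / 4 < p)
    (W : Eucl d → ℂ) (hW : MemLpAdd W ∞ p) :
    (∀ u : HSob d s, ConvExists W (absSq (HSob.toL2 u))) ∧
    (∀ (u : HSob d s) (v : L2 d), ConvExists W (reConjMul (HSob.toL2 u) v)) ∧
    ∃ (B : HSob d s → HSob d s) (B' : HSob d s → (L2 d →L[ℝ] L2 d)),
      (∀ u : HSob d s,
        (HSob.toL2 (B u) : Eucl d → ℂ) =ᵐ[volume] hartree W (HSob.toL2 u)) ∧
      (∀ (u : HSob d s) (v : L2 d),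
        (B' u v : Eucl d → ℂ) =ᵐ[volume] hartreeDeriv W (HSob.toL2 u) v) ∧
      DerivCondition HSob.toL2 B B' := by
  obtain ⟨K, hK⟩ := (hW.exists_top_two hp).exists_convBound
  choose B hB using fun u : HSob d s => hK.exists_hartree_HSob hs u
  choose B' hB' hB'n using fun u : HSob d s => hK.exists_hartreeDeriv_clm (u.memTwoTop hs)
  exact ⟨fun u => hK.convExists_absSq (u.memTwoTop hs),
    fun u v => hK.convExists_reConjMul (u.memTwoTop hs) (Lp.memLp v),
    B, B', hB, hB', hK.derivCondition hs hB hB' hB'n⟩
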